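/- Let $d\ge 2$, $n\ge 1$ be integers and $c,t>0$. A particle starts at the origin of $\mathbb{R}^d$ and moves at constant speed $c$ during $[0,t]$, changing direction exactly $n$ times. Let $\tau_1,\dots,\tau_n$ be the lengths of the first $n$ time intervals between changes of direction and $\tau_{n+1}=t-\sum_{j=1}^n\tau_j$. On the $j$-th interval, $j=1,\dots,n+1$, the direction is the unit vector $$u_j=\bigl(\cos\theta_{1,j},\ \sin\theta_{1,j}\cos\theta_{2,j},\ \dots,\ \sin\theta_{1,j}\cdots\sin\theta_{d-2,j}\cos\phi_j,\ \sin\theta_{1,j}\cdots\sin\theta_{d-2,j}\sin\phi_j\bigr),$$ where the angles $(\theta_{1,j},\dots,\theta_{d-2,j},\phi_j)\in[0,\pi]^{d-2}\times[0,2\pi]$ have joint density $$\frac{\Gamma(\frac d2)}{2\pi^{d/2}}\sin^{d-2}\theta_1\sin^{d-3}\theta_2\cdots\sin\theta_{d-2},$$ that is, $u_j$ is uniformly distributed on the unit sphere. The $n+1$ vectors of angles are mutually independent and independent of $(\tau_1,\dots,\tau_n)$. The position at time $t$ is $c\sum_{j=1}^{n+1}\tau_ju_j$. For $a>0$ consider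 the rescaled Dirichlet density with parameters $(a,\dots,a)$, $$f^{(a)}(\tau_1,\dots,\tau_n)=\frac{\Gamma((n+1)a)}{\Gamma(a)^{n+1}}\,\frac{1}{t^{(n+1)a-1}}\prod_{j=1}^{n+1}\tau_j^{a-1}\qquad\Bigl(\tau_1,\dots,\tau_n>0,\ \sum_{j=1}^n\tau_j<t\Bigr),$$ and let $J_\nu(x)=\sum_{k=0}^\infty(-1)^k\left(\frac x2\right)^{2k+\nu}\frac{1}{k!\,\Gamma(k+\nu+1)}$ be the Bessel function. (i) If $(\tau_1,\dots,\tau_n)$ has density $f^{(d-1)}$, then the position $\mathbf X_d(t)$ satisfies, for every $\alpha\in\mathbb{R}^d\setminus\{0\}$, $$E\,e^{i\langle\alpha,\mathbf X_d(t)\rangle}=\frac{2^{\frac{n+1}{2}(d-1)-\frac12}\,\Gamma\bigl(\frac{n+1}{2}(d-1)+\frac12\bigr)}{(ct\|\alpha\|)^{\frac{n+1}{2}(d-1)-\frac12}}\,J_{\frac{n+1}{2}(d-1)-\frac12}(ct\|\alpha\|).$$ (ii) If $d\ge 3$ and $(\tau_1,\dots,\tau_n)$ has density $f^{(d/2-1)}$,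 then the position, now denoted $\mathbf Y_d(t)$, satisfies, for every $\alpha\in\mathbb{R}^d\setminus\{0\}$, $$E\,e^{i\langle\alpha,\mathbf Y_d(t)\rangle}=\frac{2^{(n+1)(\frac d2-1)}\,\Gamma\bigl((n+1)(\frac d2-1)+1\bigr)}{(ct\|\alpha\|)^{(n+1)(\frac d2-1)}}\,J_{(n+1)(\frac d2-1)}(ct\|\alpha\|).$$ In both cases the characteristic function equals $1$ at $\alpha=0$. -/

import Mathlib

open MeasureTheory ProbabilityTheory

noncomputable section

namespace RandomFlight

/-- The Bessel function `J_ν(x) = ∑_k (-1)^k (x/2)^(2k+ν) / (k! Γ(k+ν+1))` (used for `0 < x`). -/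
def besselJ (ν x : ℝ) : ℝ :=
  ∑' k : ℕ, (-1 : ℝ) ^ k * (x / 2) ^ (2 * (k : ℝ) + ν) *
    (1 / ((k.factorial : ℝ) * Real.Gamma ((k : ℝ) + ν + 1)))

/-- The `n + 1` intertimes `τ₁, …, τₙ, τₙ₊₁ = t - ∑ τⱼ` determined by `τ₁, …, τₙ`. -/
def intertime {n : ℕ} (t : ℝ) (τ : Fin n → ℝ) : Fin (n + 1) → ℝ :=
  Fin.snoc τ (t - ∑ i, τ i)

open scoped Classical in
/-- The joint density of `(τ₁, …, τₙ)` when `(τ₁, …, τₙ₊₁) / t` has the Dirichlet law with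
parameters `(a, …, a)` (`n + 1` of them). -/
def dirichletDensity (n : ℕ) (a t : ℝ) (τ : Fin n → ℝ) : ℝ :=
  if (∀ i, 0 < τ i) ∧ ∑ i, τ i < t then
    Real.Gamma (((n : ℝ) + 1) * a) / Real.Gamma a ^ (n + 1) *
      (1 / t ^ (((n : ℝ) + 1) * a - 1)) * ∏ j, intertime t τ j ^ (a - 1)
  else 0

/-- The rescaled Dirichlet law of the intertimes, as a measure on `ℝⁿ`. -/
def dirichletLaw (n : ℕ) (a t : ℝ) : Measure (Fin n → ℝ) :=
  volume.withDensity fun τ => ENNReal.ofReal (dirichletDensity n a t τ)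

/-- Hyperspherical angles `((θ₁, …, θ_{d-2}), φ)`. -/
abbrev Angles (d : ℕ) : Type := (Fin (d - 2) → ℝ) × ℝ

open scoped Classical in
/-- The density
`Γ(d/2) / (2 π^(d/2)) * sin^(d-2) θ₁ * sin^(d-3) θ₂ * ⋯ * sin θ_{d-2}` on
`[0, π]^(d-2) × [0, 2π]` of the angles of a uniformly distributed direction. -/
def angleDensity (d : ℕ) (p : Angles d) : ℝ :=
  if (∀ k, p.1 k ∈ Set.Icc 0 Real.pi) ∧ p.2 ∈ Set.Icc 0 (2 * Real.pi) then
    Real.Gamma ((d : ℝ) / 2) / (2 * Real.pi ^ ((d : ℝ) / 2)) *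
      ∏ k : Fin (d - 2), Real.sin (p.1 k) ^ (d - 2 - (k : ℕ))
  else 0

/-- The law of the angles of a direction chosen uniformly on the unit sphere of `ℝᵈ`. -/
def angleLaw (d : ℕ) : Measure (Angles d) :=
  volume.withDensity fun p => ENNReal.ofReal (angleDensity d p)

/-- The unit vector of `ℝᵈ` with hyperspherical angles `p`; its coordinates are
`cos θ₁`, `sin θ₁ cos θ₂`, …, `sin θ₁ ⋯ sin θ_{d-2} cos φ`, `sin θ₁ ⋯ sin θ_{d-2} sin φ`. -/
def direction (d : ℕ) (p : Angles d) : EuclideanSpace ℝ (Fin d) :=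
  WithLp.toLp 2 fun i : Fin d =>
    (∏ k ∈ Finset.univ.filter (fun k : Fin (d - 2) => (k : ℕ) < (i : ℕ)), Real.sin (p.1 k)) *
      (if h : (i : ℕ) < d - 2 then Real.cos (p.1 ⟨i, h⟩)
        else if (i : ℕ) = d - 2 then Real.cos p.2 else Real.sin p.2)

/-- The position at time `t` of the flight with speed `c`, started at the origin, which moves for
a time `τⱼ` in the direction with angles `pⱼ`, for `j = 1, …, n + 1`. -/
def position {d n : ℕ} (c t : ℝ) (τ : Fin n → ℝ) (p : Fin (n + 1) → Angles d) :
    EuclideanSpace ℝ (Fin d) :=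
  c • ∑ j, intertime t τ j • direction d (p j)

end RandomFlight

end

/-!
The characteristic function of a uniformly distributed unit vector of `ℝᵈ` is the normalized Bessel
function `Λ_μ(x) = Γ(μ + 1) (2 / x) ^ μ J_μ(x)` with `μ = d / 2 - 1`, evaluated at the norm of the
argument (`integral_exp_direction`). This follows from the moments of linear forms of the direction
(`integral_pow_direction`), computed by induction on the dimension: the first coordinate is
`cos θ₁`, the others are `sin θ₁` times a uniform direction in one dimension less, so the binomial
formula and `∫ sin ^ p cos ^ l` suffice. The base `d = 2` has the same form, with the two-point
uniform law on the sphere of `ℝ` in place of the lower-dimensional one.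

By independence (`integral_exp_position`), the characteristic function of the position is the
average of `∏ⱼ Λ_μ(c ‖α‖ τⱼ)` over the intertimes. Under the Dirichlet law with parameters
`(a, …, a)` it is, up to a constant, the value at `t` of the `(n + 1)`-fold convolution power of
`x₊ ^ (a - 1) / Γ(a) * Λ_μ(κ x)`, where `κ = c ‖α‖`. As a series in the kernels
`x₊ ^ (a + 2 k - 1) / Γ(a + 2 k)`, which form a semigroup under convolution, this function has the
coefficients `(-1) ^ k κ ^ (2 k) besselWeight a μ k`. Hence its convolution powers are known as soon
as the weights satisfy a Vandermonde-type identity (`integral_besselKernel_conv`), and there are two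
choices of `a` for which they do:

* for `a = 2 μ + 1 = d - 1` they are the coefficients of `(1 - z) ^ (-a / 2)`, which reflects the
  Laplace transform `(s ^ 2 + κ ^ 2) ^ (-a / 2)`;
* for `a = μ = d / 2 - 1` they are, up to powers of `4`, the coefficients of the `a`-th power of the
  Catalan generating function, which reflects the Laplace transform `(√(s ^ 2 + κ ^ 2) - s) ^ a`.

Both identities come from one lemma on polynomial sequences (`sum_antidiagonal_eval_mul_eval`).
-/

noncomputable section

namespace RandomFlight

/-! ### Dirichlet integrals over the simplex -/

/-- The fractional-integration kernel `x₊ ^ (A - 1) / Γ(A)`. -/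
def gammaKernel (A x : ℝ) : ℝ := if 0 < x then x ^ (A - 1) / Real.Gamma A else 0

lemma gammaKernel_of_pos {A x : ℝ} (hx : 0 < x) :
    gammaKernel A x = x ^ (A - 1) / Real.Gamma A := if_pos hx

lemma gammaKernel_of_nonpos {A x : ℝ} (hx : x ≤ 0) : gammaKernel A x = 0 := if_neg hx.not_gt

lemma gammaKernel_nonneg {A : ℝ} (hA : 0 < A) (x : ℝ) : 0 ≤ gammaKernel A x := by
  unfold gammaKernel
  split_ifs with hx
  · exact div_nonneg (Real.rpow_nonneg hx.le _) (Real.Gamma_pos_of_pos hA).le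
  · exact le_rfl

@[fun_prop]
lemma measurable_gammaKernel (A : ℝ) : Measurable (gammaKernel A) :=
  Measurable.ite measurableSet_Ioi (by fun_prop) (by fun_prop)

lemma integrable_betaPDFReal {A B : ℝ} (hA : 0 < A) (hB : 0 < B) :
    Integrable (betaPDFReal A B) := by
  refine ⟨(stronglyMeasurable_betaPDFReal A B).aestronglyMeasurable, ?_⟩
  rw [hasFiniteIntegral_iff_ofReal]
  · change ∫⁻ x, betaPDF A B x < ⊤
    rw [lintegral_betaPDF_eq_one hA hB]
    exact ENNReal.one_lt_top
  · refine ae_of_all _ fun x => ?_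
    by_cases h : 0 < x ∧ x < 1
    · exact (betaPDFReal_pos h.1 h.2 hA hB).le
    · simp [betaPDFReal, h]

lemma integral_betaPDFReal {A B : ℝ} (hA : 0 < A) (hB : 0 < B) :
    ∫ x, betaPDFReal A B x = 1 := by
  rw [integral_eq_lintegral_of_nonneg_ae]
  · change (∫⁻ x, betaPDF A B x).toReal = 1
    rw [lintegral_betaPDF_eq_one hA hB, ENNReal.toReal_one]
  · refine ae_of_all _ fun x => ?_
    by_cases h : 0 < x ∧ x < 1
    · exact (betaPDFReal_pos h.1 h.2 hA hB).le
    · simp [betaPDFReal, h]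
  · exact (stronglyMeasurable_betaPDFReal A B).aestronglyMeasurable

lemma gammaKernel_mul_gammaKernel_sub {A B t : ℝ} (hA : 0 < A) (hB : 0 < B) (ht : 0 < t) (x : ℝ) :
    gammaKernel A x * gammaKernel B (t - x) =
      gammaKernel (A + B) t * t⁻¹ * betaPDFReal A B (x / t) := by
  unfold betaPDFReal
  have hGA := (Real.Gamma_pos_of_pos hA).ne'
  have hGB := (Real.Gamma_pos_of_pos hB).ne'
  have hGAB := (Real.Gamma_pos_of_pos (add_pos hA hB)).ne'
  by_cases hx : 0 < x
  · by_cases hxt : x < t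
    · rw [if_pos ⟨by positivity, (div_lt_one ht).2 hxt⟩, gammaKernel_of_pos hx,
        gammaKernel_of_pos (sub_pos.2 hxt), gammaKernel_of_pos ht, beta,
        show 1 - x / t = (t - x) / t by field_simp, Real.div_rpow hx.le ht.le,
        Real.div_rpow (sub_pos.2 hxt).le ht.le,
        show A + B - 1 = (A - 1) + (B - 1) + 1 by ring, Real.rpow_add ht, Real.rpow_add ht,
        Real.rpow_one]
      have h1 := (Real.rpow_pos_of_pos ht (A - 1)).ne'
      have h2 := (Real.rpow_pos_of_pos ht (B - 1)).ne'
      field_simp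
    · rw [if_neg (fun h => hxt ((div_lt_one ht).1 h.2)),
        gammaKernel_of_nonpos (x := t - x) (by linarith)]
      ring
  · rw [if_neg (fun h => hx ((div_pos_iff_of_pos_right ht).1 h.1)),
      gammaKernel_of_nonpos (not_lt.1 hx)]
    ring

lemma gammaKernel_mul_gammaKernel_sub_of_nonpos {A B t : ℝ} (ht : t ≤ 0) (x : ℝ) :
    gammaKernel A x * gammaKernel B (t - x) = 0 := by
  rcases le_or_gt x 0 with hx | hx
  · rw [gammaKernel_of_nonpos hx, zero_mul]
  · rw [gammaKernel_of_nonpos (x := t - x) (by linarith), mul_zero]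

lemma integrable_gammaKernel_conv {A B : ℝ} (hA : 0 < A) (hB : 0 < B) (t : ℝ) :
    Integrable fun x => gammaKernel A x * gammaKernel B (t - x) := by
  rcases le_or_gt t 0 with ht | ht
  · simp_rw [gammaKernel_mul_gammaKernel_sub_of_nonpos ht]
    exact integrable_zero _ _ _
  · simp_rw [gammaKernel_mul_gammaKernel_sub hA hB ht]
    exact ((integrable_betaPDFReal hA hB).comp_div ht.ne').const_mul _

/-- The semigroup property of the kernels under convolution; this is Euler's beta integral. -/
lemma integral_gammaKernel_conv {A B : ℝ} (hA : 0 < A) (hB : 0 < B) (t : ℝ) :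
    ∫ x, gammaKernel A x * gammaKernel B (t - x) = gammaKernel (A + B) t := by
  rcases le_or_gt t 0 with ht | ht
  · simp_rw [gammaKernel_mul_gammaKernel_sub_of_nonpos ht, gammaKernel_of_nonpos ht]
    simp
  · simp_rw [gammaKernel_mul_gammaKernel_sub hA hB ht]
    rw [integral_const_mul, Measure.integral_comp_div (betaPDFReal A B) t,
      integral_betaPDFReal hA hB, abs_of_pos ht, smul_eq_mul, mul_one,
      mul_assoc, inv_mul_cancel₀ ht.ne', mul_one]

lemma intertime_cons {n : ℕ} (t x : ℝ) (τ : Fin n → ℝ) :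
    intertime t (Fin.cons x τ : Fin (n + 1) → ℝ) =
      (Fin.cons x (intertime (t - x) τ) : Fin (n + 2) → ℝ) := by
  unfold intertime
  rw [Fin.sum_univ_succ]
  simp only [Fin.cons_zero, Fin.cons_succ]
  rw [← Fin.cons_snoc_eq_snoc_cons, sub_sub]

@[fun_prop]
lemma measurable_intertime {n : ℕ} (t : ℝ) (j : Fin (n + 1)) :
    Measurable fun τ : Fin n → ℝ => intertime t τ j := by
  unfold intertime
  refine Fin.lastCases ?_ (fun i => ?_) j
  · simp only [Fin.snoc_last]
    fun_prop
  · simp only [Fin.snoc_castSucc]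
    fun_prop

lemma prod_intertime_cons {n : ℕ} (f : ℝ → ℝ) (t x : ℝ) (τ : Fin n → ℝ) :
    ∏ j, f (intertime t (Fin.cons x τ : Fin (n + 1) → ℝ) j) =
      f x * ∏ j, f (intertime (t - x) τ j) := by
  rw [intertime_cons, Fin.prod_univ_succ]
  simp

lemma measurePreserving_cons (n : ℕ) :
    MeasurePreserving (MeasurableEquiv.piFinSuccAbove (fun _ : Fin (n + 1) => ℝ) 0).symm
      (volume : Measure (ℝ × (Fin n → ℝ))) (volume : Measure (Fin (n + 1) → ℝ)) :=
  (volume_preserving_piFinSuccAbove (fun _ : Fin (n + 1) => ℝ) 0).symm _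

lemma piFinSuccAbove_symm_apply_eq_cons {n : ℕ} (z : ℝ × (Fin n → ℝ)) :
    (MeasurableEquiv.piFinSuccAbove (fun _ : Fin (n + 1) => ℝ) 0).symm z =
      (Fin.cons z.1 z.2 : Fin (n + 1) → ℝ) := by
  simp [MeasurableEquiv.piFinSuccAbove, Fin.insertNthEquiv]

lemma integrable_iff_integrable_cons {n : ℕ} (g : (Fin (n + 1) → ℝ) → ℝ) :
    Integrable g ↔ Integrable (fun z : ℝ × (Fin n → ℝ) => g (Fin.cons z.1 z.2)) := by
  rw [← (measurePreserving_cons n).integrable_comp_emb (MeasurableEquiv.measurableEmbedding _)]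
  simp only [Function.comp_def, piFinSuccAbove_symm_apply_eq_cons]

lemma integral_eq_integral_cons {n : ℕ} (g : (Fin (n + 1) → ℝ) → ℝ) :
    ∫ τ, g τ = ∫ z : ℝ × (Fin n → ℝ), g (Fin.cons z.1 z.2) := by
  rw [← (measurePreserving_cons n).integral_comp']
  simp only [piFinSuccAbove_symm_apply_eq_cons]

lemma integral_prod_intertime_zero (f : ℝ → ℝ) (t : ℝ) :
    ∫ τ : Fin 0 → ℝ, ∏ j, f (intertime t τ j) = f t := by
  rw [volume_pi, Measure.pi_of_empty _ 0, integral_dirac]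
  simp [intertime, Fin.snoc]

/-- Dirichlet's integral, with equal parameters: the `n + 1` intertimes of sum `t` turn the integral
over `ℝⁿ` into the `(n + 1)`-fold convolution power of the kernel. -/
lemma integrable_prod_gammaKernel {A : ℝ} (hA : 0 < A) (n : ℕ) (t : ℝ) :
    Integrable (fun τ : Fin n → ℝ => ∏ j, gammaKernel A (intertime t τ j)) ∧
      ∫ τ : Fin n → ℝ, ∏ j, gammaKernel A (intertime t τ j) = gammaKernel ((n + 1) * A) t := by
  induction n generalizing t with
  | zero =>
    constructor
    · rw [volume_pi, Measure.pi_of_empty _ 0]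
      exact integrable_dirac (by simp)
    · rw [integral_prod_intertime_zero]
      simp
  | succ n ih =>
    have key : ∀ x, ∫ τ : Fin n → ℝ, gammaKernel A x * ∏ j, gammaKernel A (intertime (t - x) τ j) =
        gammaKernel A x * gammaKernel ((n + 1) * A) (t - x) := by
      intro x
      rw [integral_const_mul, (ih _).2]
    have hB : 0 < ((n : ℝ) + 1) * A := by positivity
    have hint : Integrable (fun z : ℝ × (Fin n → ℝ) =>
        ∏ j, gammaKernel A (intertime t (Fin.cons z.1 z.2 : Fin (n + 1) → ℝ) j)) := by
      have hm : Measurable (fun z : ℝ × (Fin n → ℝ) =>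
        ∏ j, gammaKernel A (intertime t (Fin.cons z.1 z.2 : Fin (n + 1) → ℝ) j)) := by
        have hc : Measurable fun z : ℝ × (Fin n → ℝ) => (Fin.cons z.1 z.2 : Fin (n + 1) → ℝ) := by
          simp_rw [← piFinSuccAbove_symm_apply_eq_cons]
          exact MeasurableEquiv.measurable _
        exact Finset.measurable_prod _ fun j _ =>
          (measurable_gammaKernel A).comp ((measurable_intertime t j).comp hc)
      rw [Measure.volume_eq_prod, integrable_prod_iff hm.aestronglyMeasurable]
      simp only [prod_intertime_cons]
      refine ⟨ae_of_all _ fun x => (ih _).1.const_mul _, ?_⟩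
      have hn : ∀ (x : ℝ) (τ : Fin n → ℝ),
          ‖gammaKernel A x * ∏ j, gammaKernel A (intertime (t - x) τ j)‖ =
            gammaKernel A x * ∏ j, gammaKernel A (intertime (t - x) τ j) := fun x τ =>
        Real.norm_of_nonneg (mul_nonneg (gammaKernel_nonneg hA _)
          (Finset.prod_nonneg fun j _ => gammaKernel_nonneg hA _))
      simp only [hn, key]
      exact integrable_gammaKernel_conv hA hB t
    refine ⟨(integrable_iff_integrable_cons _).2 hint, ?_⟩
    rw [integral_eq_integral_cons, Measure.volume_eq_prod, integral_prod _ hint]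
    simp only [prod_intertime_cons, key]
    rw [integral_gammaKernel_conv hA hB]
    congr 1
    push_cast
    ring

lemma integrable_prod_of_le_gammaKernel {A : ℝ} (hA : 0 < A) {f : ℝ → ℝ} (hf : Measurable f)
    (hfA : ∀ x, |f x| ≤ gammaKernel A x) (n : ℕ) (t : ℝ) :
    Integrable (fun τ : Fin n → ℝ => ∏ j, f (intertime t τ j)) := by
  refine (integrable_prod_gammaKernel hA n t).1.mono' ?_ (ae_of_all _ fun τ => ?_)
  · exact (Finset.measurable_prod _ fun j _ =>
      hf.comp (measurable_intertime t j)).aestronglyMeasurable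
  · rw [Real.norm_eq_abs, Finset.abs_prod]
    exact Finset.prod_le_prod (fun _ _ => abs_nonneg _) fun j _ => hfA _

/-- Integrating out the first intertime turns the integral over the simplex into a convolution. -/
lemma integral_prod_intertime_succ {A : ℝ} (hA : 0 < A) {f : ℝ → ℝ} (hf : Measurable f)
    (hfA : ∀ x, |f x| ≤ gammaKernel A x) (n : ℕ) (t : ℝ) :
    ∫ τ : Fin (n + 1) → ℝ, ∏ j, f (intertime t τ j) =
      ∫ x, f x * ∫ τ : Fin n → ℝ, ∏ j, f (intertime (t - x) τ j) := by
  have hint := (integrable_iff_integrable_cons _).1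
    (integrable_prod_of_le_gammaKernel hA hf hfA (n + 1) t)
  rw [integral_eq_integral_cons, Measure.volume_eq_prod, integral_prod _ hint]
  simp only [prod_intertime_cons, integral_const_mul]

/-! ### Coefficient identities of convolution type -/

section

open Polynomial

/-- If the polynomials `P k` satisfy `P (k + 1) (a) - P (k + 1) (a - 1) = P k (a + s)`, with
`P 0 = 1` and `P (k + 1)` vanishing at `0`, then they are of convolution type: for fixed `b`, both
sides agree for `a ∈ ℕ` by induction, and they are polynomials in `a`. -/
lemma sum_antidiagonal_eval_mul_eval (P : ℕ → ℝ[X]) (s : ℝ) (h0 : P 0 = 1)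
    (hz : ∀ k, (P (k + 1)).eval 0 = 0)
    (hP : ∀ k a, (P (k + 1)).eval a = (P (k + 1)).eval (a - 1) + (P k).eval (a + s))
    (k : ℕ) (a b : ℝ) :
    ∑ p ∈ Finset.HasAntidiagonal.antidiagonal k, (P p.1).eval a * (P p.2).eval b =
      (P k).eval (a + b) := by
  induction k generalizing a with
  | zero => simp [h0]
  | succ k ih =>
    -- `D` is the difference of the two sides as a polynomial in `a`.
    set D : ℝ[X] :=
      (∑ p ∈ Finset.HasAntidiagonal.antidiagonal (k + 1), P p.1 * C ((P p.2).eval b)) -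
      (P (k + 1)).comp (X + C b) with hD
    have hDe : ∀ x, D.eval x =
        ∑ p ∈ Finset.HasAntidiagonal.antidiagonal (k + 1), (P p.1).eval x * (P p.2).eval b -
          (P (k + 1)).eval (x + b) := by
      intro x
      simp [hD, eval_finsetSum]
    have hD0 : D.eval 0 = 0 := by
      rw [hDe, Finset.Nat.sum_antidiagonal_succ]
      simp [h0, hz]
    have hstep : ∀ x, D.eval x = D.eval (x - 1) := by
      intro x
      have h1 := ih (x + s)
      rw [hDe, hDe, Finset.Nat.sum_antidiagonal_succ, Finset.Nat.sum_antidiagonal_succ]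
      simp only [h0, eval_one, hP _ x, add_mul, Finset.sum_add_distrib, h1]
      have h2 := hP k (x + b)
      rw [show x + b - 1 = x - 1 + b by ring, show x + b + s = x + s + b by ring] at h2
      linarith
    have hnat : ∀ m : ℕ, D.eval (m : ℝ) = 0 := by
      intro m
      induction m with
      | zero => simpa using hD0
      | succ m ihm =>
        rw [hstep]
        simpa using ihm
    have hDz : D = 0 := by
      refine eq_zero_of_infinite_isRoot D ?_
      refine (Set.infinite_range_of_injective (Nat.cast_injective (R := ℝ))).mono ?_
      rintro _ ⟨m, rfl⟩
      exact hnat m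
    have := hDe a
    rw [hDz, eval_zero] at this
    linarith

/-- The coefficients of `(1 - z) ^ (-a)`, as polynomials in `a`. -/
def risingPoly (k : ℕ) : ℝ[X] := C ((k.factorial : ℝ)⁻¹) * ascPochhammer ℝ k

lemma sum_antidiagonal_risingPoly (k : ℕ) (a b : ℝ) :
    ∑ p ∈ Finset.HasAntidiagonal.antidiagonal k, (risingPoly p.1).eval a * (risingPoly p.2).eval b =
      (risingPoly k).eval (a + b) := by
  refine sum_antidiagonal_eval_mul_eval risingPoly 0 (by simp [risingPoly]) (fun k => ?_)
    (fun k a => ?_) k a b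
  · simp [risingPoly]
  · have h1 : (ascPochhammer ℝ (k + 1)).eval a = (ascPochhammer ℝ k).eval a * (a + k) :=
      ascPochhammer_succ_eval k a
    have h2 : (ascPochhammer ℝ (k + 1)).eval (a - 1) = (a - 1) * (ascPochhammer ℝ k).eval a := by
      rw [ascPochhammer_succ_left]
      simp
    have hk : (k.factorial : ℝ) ≠ 0 := by positivity
    simp only [risingPoly, eval_mul, eval_C, h1, h2, add_zero, Nat.factorial_succ]
    push_cast
    field_simp
    ring

/-- The coefficients `a / (a + 2 k) * (a + 2 k).choose k` of the `a`-th power of the Catalan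
generating function, as polynomials in `a`. -/
def catalanPoly : ℕ → ℝ[X]
  | 0 => 1
  | k + 1 => C (((k + 1).factorial : ℝ)⁻¹) * (X * (ascPochhammer ℝ k).comp (X + C ((k : ℝ) + 2)))

lemma sum_antidiagonal_catalanPoly (k : ℕ) (a b : ℝ) :
    ∑ p ∈ Finset.HasAntidiagonal.antidiagonal k,
        (catalanPoly p.1).eval a * (catalanPoly p.2).eval b =
      (catalanPoly k).eval (a + b) := by
  refine sum_antidiagonal_eval_mul_eval catalanPoly 1 rfl (fun k => ?_) (fun k a => ?_) k a b
  · simp [catalanPoly]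
  · rcases k with _ | k
    · simp [catalanPoly]
    · have h1 : (ascPochhammer ℝ (k + 1)).eval (a + ((k + 1 : ℕ) + 2)) =
          (ascPochhammer ℝ k).eval (a + (k + 3)) * (a + (2 * k + 3)) := by
        rw [ascPochhammer_succ_eval]
        push_cast
        ring_nf
      have h2 : (ascPochhammer ℝ (k + 1)).eval (a - 1 + ((k + 1 : ℕ) + 2)) =
          (a + (k + 2)) * (ascPochhammer ℝ k).eval (a + (k + 3)) := by
        rw [ascPochhammer_succ_left]
        simp only [eval_mul, eval_X, eval_comp, eval_add, eval_one]
        push_cast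
        ring_nf
      have h3 : (ascPochhammer ℝ k).eval (a + 1 + (k + 2)) =
          (ascPochhammer ℝ k).eval (a + (k + 3)) := by
        ring_nf
      have hk : ((k + 1).factorial : ℝ) ≠ 0 := by positivity
      simp only [catalanPoly, eval_mul, eval_C, eval_X, eval_comp, eval_add, h1, h2, h3]
      rw [Nat.factorial_succ (k + 1)]
      push_cast
      field_simp
      ring

lemma Gamma_add_nat {a : ℝ} (ha : 0 < a) (k : ℕ) :
    Real.Gamma (a + k) = Real.Gamma a * (ascPochhammer ℝ k).eval a := by
  induction k with
  | zero => simp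
  | succ k ih =>
    have : a + (k : ℝ) ≠ 0 := by positivity
    rw [ascPochhammer_succ_eval, ← mul_assoc, ← ih, Nat.cast_succ, ← add_assoc,
      Real.Gamma_add_one this, mul_comm]

/-- The weights for which `gammaKernel A x * normBessel μ (κ x)` is the series
`∑ (-1) ^ k κ ^ (2 k) besselWeight A μ k * gammaKernel (A + 2 k) x`. -/
def besselWeight (A μ : ℝ) (k : ℕ) : ℝ :=
  Real.Gamma (A + 2 * k) / Real.Gamma A *
    (Real.Gamma (μ + 1) / (4 ^ k * (k.factorial * Real.Gamma (k + μ + 1))))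

lemma besselWeight_nonneg {A μ : ℝ} (hA : 0 < A) (hμ : 0 < μ + 1) (k : ℕ) :
    0 ≤ besselWeight A μ k := by
  have h1 := Real.Gamma_pos_of_pos hA
  have h2 := Real.Gamma_pos_of_pos (show 0 < A + 2 * (k : ℝ) by positivity)
  have h3 := Real.Gamma_pos_of_pos hμ
  have h4 := Real.Gamma_pos_of_pos (show 0 < (k : ℝ) + μ + 1 by rw [add_assoc]; positivity)
  unfold besselWeight
  positivity

/-- Legendre's duplication formula identifies the weights for `A = 2 μ + 1`. -/
lemma besselWeight_half_eq {A : ℝ} (hA : 0 < A) (k : ℕ) :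
    besselWeight A (A / 2 - 1 / 2) k = (risingPoly k).eval (A / 2) := by
  have hA2 : 0 < A / 2 := by positivity
  have hk : (0 : ℝ) ≤ k := by positivity
  have d0 := Real.Gamma_mul_Gamma_add_half (A / 2)
  have d1 := Real.Gamma_mul_Gamma_add_half (A / 2 + k)
  have hp := Gamma_add_nat hA2 k
  rw [show 2 * (A / 2) = A by ring] at d0
  rw [show 2 * (A / 2 + (k : ℝ)) = A + 2 * k by ring] at d1
  have e : (2 : ℝ) ^ (1 - A) = 2 ^ (1 - (A + 2 * k)) * 4 ^ k := by
    rw [show (4 : ℝ) = 2 ^ (2 : ℝ) by norm_num, ← Real.rpow_mul_natCast (by norm_num),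
      ← Real.rpow_add (by norm_num)]
    congr 1
    ring
  unfold besselWeight
  rw [show A / 2 - 1 / 2 + 1 = A / 2 + 1 / 2 by ring,
    show (k : ℝ) + (A / 2 - 1 / 2) + 1 = A / 2 + k + 1 / 2 by ring]
  have g1 := (Real.Gamma_pos_of_pos hA).ne'
  have g2 := (Real.Gamma_pos_of_pos hA2).ne'
  have g3 := (Real.Gamma_pos_of_pos (show 0 < A / 2 + (k : ℝ) + 1 / 2 by positivity)).ne'
  have g4 := (Real.Gamma_pos_of_pos (show 0 < A / 2 + (k : ℝ) by positivity)).ne'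
  have hf : (k.factorial : ℝ) ≠ 0 := by positivity
  have hpi : √Real.pi ≠ 0 := by positivity
  have h2p := (Real.rpow_pos_of_pos (zero_lt_two' ℝ) (1 - (A + 2 * k))).ne'
  simp only [risingPoly, eval_mul, eval_C]
  have hp' : (ascPochhammer ℝ k).eval (A / 2) = Real.Gamma (A / 2 + k) / Real.Gamma (A / 2) := by
    rw [hp]; field_simp
  rw [hp']
  have d0' : Real.Gamma (A / 2 + 1 / 2) =
      Real.Gamma A * (2 ^ (1 - (A + 2 * k)) * 4 ^ k) * √Real.pi / Real.Gamma (A / 2) := by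
    rw [← e, ← d0]; field_simp
  have d1' : Real.Gamma (A + 2 * k) = Real.Gamma (A / 2 + k) * Real.Gamma (A / 2 + k + 1 / 2) /
      (2 ^ (1 - (A + 2 * k)) * √Real.pi) := by
    rw [d1]; field_simp
  rw [d0', d1']
  field_simp

lemma besselWeight_self_eq {A : ℝ} (hA : 0 < A) (k : ℕ) :
    besselWeight A A k = (catalanPoly k).eval A / 4 ^ k := by
  have g1 := (Real.Gamma_pos_of_pos hA).ne'
  unfold besselWeight
  rw [Real.Gamma_add_one hA.ne']
  rcases k with _ | k
  · simp only [catalanPoly, eval_one, Nat.cast_zero, mul_zero, add_zero, pow_zero, zero_add,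
      Nat.factorial_zero, Nat.cast_one, Real.Gamma_add_one hA.ne']
    field_simp
  · have hf : ((k + 1).factorial : ℝ) ≠ 0 := by positivity
    have hp := Gamma_add_nat (show 0 < A + (k + 2) by positivity) k
    have g2 := (Real.Gamma_pos_of_pos (show 0 < A + ((k : ℝ) + 2) by positivity)).ne'
    simp only [catalanPoly, eval_mul, eval_C, eval_X, eval_comp, eval_add]
    rw [show ((k + 1 : ℕ) : ℝ) + A + 1 = A + (k + 2) by push_cast; ring,
      show A + 2 * ((k + 1 : ℕ) : ℝ) = A + (k + 2) + k by push_cast; ring, hp]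
    field_simp

lemma sum_antidiagonal_besselWeight_half {A B : ℝ} (hA : 0 < A) (hB : 0 < B) (k : ℕ) :
    ∑ p ∈ Finset.HasAntidiagonal.antidiagonal k,
        besselWeight A (A / 2 - 1 / 2) p.1 * besselWeight B (B / 2 - 1 / 2) p.2 =
      besselWeight (A + B) ((A + B) / 2 - 1 / 2) k := by
  simp only [besselWeight_half_eq hA, besselWeight_half_eq hB, sum_antidiagonal_risingPoly]
  rw [besselWeight_half_eq (add_pos hA hB), add_div]

lemma sum_antidiagonal_besselWeight_self {A B : ℝ} (hA : 0 < A) (hB : 0 < B) (k : ℕ) :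
    ∑ p ∈ Finset.HasAntidiagonal.antidiagonal k, besselWeight A A p.1 * besselWeight B B p.2 =
      besselWeight (A + B) (A + B) k := by
  simp only [besselWeight_self_eq hA, besselWeight_self_eq hB, besselWeight_self_eq (add_pos hA hB),
    ← sum_antidiagonal_catalanPoly, Finset.sum_div]
  refine Finset.sum_congr rfl fun p hp => ?_
  rw [← Finset.HasAntidiagonal.mem_antidiagonal.1 hp, pow_add]
  field_simp

end

/-! ### Convolution of Bessel kernels -/

/-- The normalized Bessel function `Γ(μ + 1) (2 / x) ^ μ J_μ(x)`, as an entire even series, with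
value `1` at `0`. -/
def normBessel (μ x : ℝ) : ℝ :=
  ∑' k : ℕ, (-1 : ℝ) ^ k * ((x / 2) ^ (2 * k) *
    (Real.Gamma (μ + 1) / (k.factorial * Real.Gamma (k + μ + 1))))

lemma normBessel_neg (μ x : ℝ) : normBessel μ (-x) = normBessel μ x := by
  unfold normBessel
  refine tsum_congr fun k => ?_
  rw [neg_div, (even_two_mul k).neg_pow]

lemma besselJ_eq_normBessel {μ x : ℝ} (hμ : 0 < μ + 1) (hx : 0 < x) :
    (2 : ℝ) ^ μ * Real.Gamma (μ + 1) / x ^ μ * besselJ μ x = normBessel μ x := by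
  unfold besselJ normBessel
  rw [← tsum_mul_left]
  refine tsum_congr fun k => ?_
  rw [Real.rpow_add (by positivity), Real.div_rpow hx.le (by norm_num) μ,
    show (2 * (k : ℝ)) = ((2 * k : ℕ) : ℝ) by push_cast; ring, Real.rpow_natCast]
  have h1 := (Real.rpow_pos_of_pos hx μ).ne'
  have h2 := (Real.rpow_pos_of_pos (zero_lt_two' ℝ) μ).ne'
  field_simp

/-- `Γ` is bounded below along `c + ℕ`, as it increases there from the second term on. -/
lemma min_Gamma_le_Gamma_add_nat {c : ℝ} (hc : 0 < c) (k : ℕ) :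
    min (Real.Gamma c) (Real.Gamma (c + 1)) ≤ Real.Gamma (k + c) := by
  rcases k with _ | k
  · simp
  · refine (min_le_right _ _).trans ?_
    induction k with
    | zero => simp [add_comm]
    | succ k ih =>
      refine ih.trans ?_
      have h : 0 < ((k + 1 : ℕ) : ℝ) + c := by positivity
      have h1 : (1 : ℝ) ≤ ((k + 1 : ℕ) : ℝ) + c := by
        push_cast
        linarith [k.cast_nonneg (α := ℝ)]
      rw [show ((k + 1 + 1 : ℕ) : ℝ) + c = ((k + 1 : ℕ) : ℝ) + c + 1 by push_cast; ring,
        Real.Gamma_add_one h.ne']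
      exact le_mul_of_one_le_left (Real.Gamma_pos_of_pos h).le h1

lemma summable_normBessel {μ : ℝ} (hμ : 0 < μ + 1) (x : ℝ) :
    Summable fun k : ℕ => (x / 2) ^ (2 * k) *
      (Real.Gamma (μ + 1) / (k.factorial * Real.Gamma (k + μ + 1))) := by
  have hg : ∀ k : ℕ, 0 < Real.Gamma (k + μ + 1) := fun k =>
    Real.Gamma_pos_of_pos (by rw [add_assoc]; positivity)
  have hm : 0 < min (Real.Gamma (μ + 1)) (Real.Gamma (μ + 1 + 1)) :=
    lt_min (Real.Gamma_pos_of_pos hμ) (Real.Gamma_pos_of_pos (by linarith))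
  refine Summable.of_nonneg_of_le (fun k => ?_) (fun k => ?_)
    ((Real.summable_pow_div_factorial ((x / 2) ^ 2)).mul_right
      (Real.Gamma (μ + 1) / min (Real.Gamma (μ + 1)) (Real.Gamma (μ + 1 + 1))))
  · have := hg k
    have := Real.Gamma_pos_of_pos hμ
    have h2 : 0 ≤ (x / 2) ^ (2 * k) := (even_two_mul k).pow_nonneg _
    positivity
  · rw [pow_mul, div_mul_eq_mul_div, mul_div_assoc, ← div_div, div_right_comm]
    have h2 : 0 ≤ ((x / 2) ^ 2) ^ k := by positivity
    have := Real.Gamma_pos_of_pos hμ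
    have := min_Gamma_le_Gamma_add_nat hμ k
    rw [← add_assoc] at this
    gcongr

@[fun_prop]
lemma measurable_normBessel {μ : ℝ} (hμ : 0 < μ + 1) : Measurable (normBessel μ) := by
  refine measurable_of_tendsto_metrizable (f := fun n x => ∑ k ∈ Finset.range n,
    (-1 : ℝ) ^ k * ((x / 2) ^ (2 * k) *
      (Real.Gamma (μ + 1) / (k.factorial * Real.Gamma (k + μ + 1))))) (fun n => by fun_prop) ?_
  rw [tendsto_pi_nhds]
  intro x
  refine (Summable.hasSum ?_).tendsto_sum_nat
  refine Summable.of_norm ?_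
  simp only [norm_mul, norm_pow, norm_neg, norm_one, one_pow, one_mul]
  simpa only [norm_mul, norm_pow] using (summable_normBessel hμ x).norm

/-- The kernel `x₊ ^ (A - 1) / Γ(A) * Γ(μ + 1) (2 / κ x) ^ μ J_μ(κ x)`. -/
def besselKernel (A μ κ x : ℝ) : ℝ := gammaKernel A x * normBessel μ (κ * x)

lemma besselKernel_term {A : ℝ} (hA : 0 < A) (μ κ x : ℝ) (k : ℕ) :
    κ ^ (2 * k) * besselWeight A μ k * gammaKernel (A + 2 * k) x =
      gammaKernel A x * ((κ * x / 2) ^ (2 * k) *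
        (Real.Gamma (μ + 1) / (k.factorial * Real.Gamma (k + μ + 1)))) := by
  rcases le_or_gt x 0 with hx | hx
  · simp [gammaKernel_of_nonpos hx]
  · rw [gammaKernel_of_pos hx, gammaKernel_of_pos hx,
      show A + 2 * (k : ℝ) - 1 = (A - 1) + (2 * k : ℕ) by push_cast; ring, Real.rpow_add hx,
      Real.rpow_natCast, besselWeight, div_pow, mul_pow, pow_mul (2 : ℝ)]
    have h1 := (Real.Gamma_pos_of_pos hA).ne'
    have h2 := (Real.Gamma_pos_of_pos (show 0 < A + 2 * (k : ℝ) by positivity)).ne'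
    norm_num
    field_simp

lemma summable_besselKernel {A μ : ℝ} (hA : 0 < A) (hμ : 0 < μ + 1) (κ x : ℝ) :
    Summable fun k : ℕ => κ ^ (2 * k) * besselWeight A μ k * gammaKernel (A + 2 * k) x := by
  simp_rw [besselKernel_term hA]
  exact (summable_normBessel hμ (κ * x)).mul_left _

lemma norm_besselKernel_term {A μ : ℝ} (hA : 0 < A) (hμ : 0 < μ + 1) (κ x : ℝ) (k : ℕ) :
    ‖(-1 : ℝ) ^ k * (κ ^ (2 * k) * besselWeight A μ k * gammaKernel (A + 2 * k) x)‖ =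
      κ ^ (2 * k) * besselWeight A μ k * gammaKernel (A + 2 * k) x := by
  rw [norm_mul, norm_pow, norm_neg, norm_one, one_pow, one_mul, Real.norm_of_nonneg]
  have h1 := besselWeight_nonneg hA hμ k
  have h2 := gammaKernel_nonneg (show 0 < A + 2 * (k : ℝ) by positivity) x
  have h3 : 0 ≤ κ ^ (2 * k) := (even_two_mul k).pow_nonneg _
  positivity

lemma hasSum_besselKernel {A μ : ℝ} (hA : 0 < A) (hμ : 0 < μ + 1) (κ x : ℝ) :
    HasSum (fun k : ℕ => (-1 : ℝ) ^ k *
      (κ ^ (2 * k) * besselWeight A μ k * gammaKernel (A + 2 * k) x)) (besselKernel A μ κ x) := by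
  have hs : Summable fun k : ℕ => (-1 : ℝ) ^ k *
      (κ ^ (2 * k) * besselWeight A μ k * gammaKernel (A + 2 * k) x) := by
    refine Summable.of_norm ?_
    simp_rw [norm_besselKernel_term hA hμ]
    exact summable_besselKernel hA hμ κ x
  convert! hs.hasSum using 1
  rw [besselKernel, normBessel, ← tsum_mul_left]
  refine tsum_congr fun k => ?_
  rw [besselKernel_term hA]
  ring

/-- A relation of convolution type between the weights turns into a convolution identity between
the kernels, by integrating the product of the two series term by term. -/
lemma integral_besselKernel_conv {μ : ℝ → ℝ} (hμ : ∀ A, 0 < A → 0 < μ A + 1)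
    (hw : ∀ A B, 0 < A → 0 < B → ∀ k,
      ∑ p ∈ Finset.HasAntidiagonal.antidiagonal k,
        besselWeight A (μ A) p.1 * besselWeight B (μ B) p.2 = besselWeight (A + B) (μ (A + B)) k)
    {A B : ℝ} (hA : 0 < A) (hB : 0 < B) (κ t : ℝ) :
    ∫ x, besselKernel A (μ A) κ x * besselKernel B (μ B) κ (t - x) =
      besselKernel (A + B) (μ (A + B)) κ t := by
  have hAB := add_pos hA hB
  set a : ℕ → ℝ → ℝ := fun k x =>
    (-1 : ℝ) ^ k * (κ ^ (2 * k) * besselWeight A (μ A) k * gammaKernel (A + 2 * k) x) with ha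
  set b : ℕ → ℝ → ℝ := fun k x =>
    (-1 : ℝ) ^ k * (κ ^ (2 * k) * besselWeight B (μ B) k * gammaKernel (B + 2 * k) x) with hb
  have hprod : ∀ (p : ℕ × ℕ) (x : ℝ), a p.1 x * b p.2 (t - x) =
      ((-1 : ℝ) ^ (p.1 + p.2) * κ ^ (2 * (p.1 + p.2)) *
        (besselWeight A (μ A) p.1 * besselWeight B (μ B) p.2)) *
        (gammaKernel (A + 2 * p.1) x * gammaKernel (B + 2 * p.2) (t - x)) := by
    intro p x
    simp only [ha, hb]
    ring
  have hA' : ∀ k : ℕ, 0 < A + 2 * (k : ℝ) := fun k => by positivity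
  have hB' : ∀ k : ℕ, 0 < B + 2 * (k : ℝ) := fun k => by positivity
  have hint : ∀ p : ℕ × ℕ, Integrable fun x => a p.1 x * b p.2 (t - x) := by
    intro p
    simp_rw [hprod]
    exact (integrable_gammaKernel_conv (hA' _) (hB' _) t).const_mul _
  have hval : ∀ p : ℕ × ℕ, ∫ x, a p.1 x * b p.2 (t - x) =
      (-1 : ℝ) ^ (p.1 + p.2) * (κ ^ (2 * (p.1 + p.2)) *
        (besselWeight A (μ A) p.1 * besselWeight B (μ B) p.2) *
        gammaKernel (A + B + 2 * (p.1 + p.2 : ℕ)) t) := by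
    intro p
    simp_rw [hprod]
    rw [integral_const_mul, integral_gammaKernel_conv (hA' _) (hB' _)]
    push_cast
    rw [show A + 2 * (p.1 : ℝ) + (B + 2 * p.2) = A + B + 2 * (p.1 + p.2) by ring]
    ring
  have hvaln : ∀ p : ℕ × ℕ, ∫ x, ‖a p.1 x * b p.2 (t - x)‖ =
      κ ^ (2 * (p.1 + p.2)) * (besselWeight A (μ A) p.1 * besselWeight B (μ B) p.2) *
        gammaKernel (A + B + 2 * (p.1 + p.2 : ℕ)) t := by
    intro p
    have hn : ∀ x, ‖a p.1 x * b p.2 (t - x)‖ = (κ ^ (2 * (p.1 + p.2)) *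
        (besselWeight A (μ A) p.1 * besselWeight B (μ B) p.2)) *
        (gammaKernel (A + 2 * p.1) x * gammaKernel (B + 2 * p.2) (t - x)) := by
      intro x
      simp only [ha, hb]
      rw [norm_mul, norm_besselKernel_term hA (hμ A hA),
        norm_besselKernel_term hB (hμ B hB)]
      ring
    simp_rw [hn]
    rw [integral_const_mul, integral_gammaKernel_conv (hA' _) (hB' _)]
    push_cast
    rw [show A + 2 * (p.1 : ℝ) + (B + 2 * p.2) = A + B + 2 * (p.1 + p.2) by ring]
  have hfib : ∀ (k : ℕ) (g : ℕ → ℝ), ∑ p : Finset.HasAntidiagonal.antidiagonal k,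
      g ((p : ℕ × ℕ).1 + (p : ℕ × ℕ).2) *
        (besselWeight A (μ A) (p : ℕ × ℕ).1 * besselWeight B (μ B) (p : ℕ × ℕ).2) =
      g k * besselWeight (A + B) (μ (A + B)) k := by
    intro k g
    rw [← hw A B hA hB k, Finset.mul_sum]
    rw [Finset.sum_coe_sort (Finset.HasAntidiagonal.antidiagonal k)
      (fun p : ℕ × ℕ => g (p.1 + p.2) * (besselWeight A (μ A) p.1 * besselWeight B (μ B) p.2))]
    refine Finset.sum_congr rfl fun p hp => ?_
    rw [Finset.HasAntidiagonal.mem_antidiagonal.1 hp]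
  have hsum : Summable fun p : ℕ × ℕ => ∫ x, ‖a p.1 x * b p.2 (t - x)‖ := by
    rw [← Finset.HasAntidiagonal.sigmaAntidiagonalEquivProd.summable_iff]
    have hnn : ∀ q, 0 ≤ ((fun p : ℕ × ℕ => ∫ x, ‖a p.1 x * b p.2 (t - x)‖) ∘
        Finset.HasAntidiagonal.sigmaAntidiagonalEquivProd) q :=
      fun q => integral_nonneg fun x => norm_nonneg _
    refine (summable_sigma_of_nonneg hnn).2 ⟨fun k => Summable.of_finite, ?_⟩
    convert! summable_besselKernel hAB (hμ _ hAB) κ t using 2 with k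
    rw [tsum_fintype]
    simp only [Function.comp_def, Finset.HasAntidiagonal.sigmaAntidiagonalEquivProd_apply, hvaln]
    rw [mul_right_comm, ← hfib k fun k => κ ^ (2 * k) * gammaKernel (A + B + 2 * k) t]
    exact Finset.sum_congr rfl fun _ _ => by ring
  have hS := hasSum_integral_of_summable_integral_norm hint hsum
  have hinner : ∀ x, ∑' p : ℕ × ℕ, a p.1 x * b p.2 (t - x) =
      besselKernel A (μ A) κ x * besselKernel B (μ B) κ (t - x) := by
    intro x
    rw [← (hasSum_besselKernel hA (hμ A hA) κ x).tsum_eq,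
      ← (hasSum_besselKernel hB (hμ B hB) κ (t - x)).tsum_eq]
    refine (tsum_mul_tsum_of_summable_norm (f := fun k => a k x)
      (g := fun k => b k (t - x)) ?_ ?_).symm
    · simp_rw [ha, norm_besselKernel_term hA (hμ A hA)]
      exact summable_besselKernel hA (hμ A hA) κ x
    · simp_rw [hb, norm_besselKernel_term hB (hμ B hB)]
      exact summable_besselKernel hB (hμ B hB) κ (t - x)
  simp_rw [hinner] at hS
  rw [← Finset.HasAntidiagonal.sigmaAntidiagonalEquivProd.hasSum_iff] at hS
  have hS' := hS.sigma fun k => hasSum_fintype _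
  refine hS'.unique ?_
  convert! hasSum_besselKernel hAB (hμ _ hAB) κ t using 2 with k
  simp only [Function.comp_def, Finset.HasAntidiagonal.sigmaAntidiagonalEquivProd_apply, hval]
  rw [mul_right_comm, ← mul_assoc,
    ← hfib k fun k => (-1) ^ k * (κ ^ (2 * k) * gammaKernel (A + B + 2 * k) t)]
  exact Finset.sum_congr rfl fun _ _ => by ring

lemma measurable_besselKernel {A μ : ℝ} (hμ : 0 < μ + 1) (κ : ℝ) :
    Measurable (besselKernel A μ κ) :=
  (measurable_gammaKernel A).mul ((measurable_normBessel hμ).comp (measurable_const_mul κ))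

/-- The bound on `normBessel` serves only to justify Fubini's theorem. -/
lemma integral_prod_besselKernel {μ : ℝ → ℝ} (hμ : ∀ A, 0 < A → 0 < μ A + 1)
    (hw : ∀ A B, 0 < A → 0 < B → ∀ k,
      ∑ p ∈ Finset.HasAntidiagonal.antidiagonal k,
        besselWeight A (μ A) p.1 * besselWeight B (μ B) p.2 = besselWeight (A + B) (μ (A + B)) k)
    {A : ℝ} (hA : 0 < A) (hb : ∀ x, |normBessel (μ A) x| ≤ 1) (κ : ℝ) (n : ℕ) (t : ℝ) :
    ∫ τ : Fin n → ℝ, ∏ j, besselKernel A (μ A) κ (intertime t τ j) =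
      besselKernel ((n + 1) * A) (μ ((n + 1) * A)) κ t := by
  induction n generalizing t with
  | zero => rw [integral_prod_intertime_zero]; simp
  | succ n ih =>
    rw [integral_prod_intertime_succ hA (measurable_besselKernel (hμ A hA) κ) (fun x => ?_)]
    · simp_rw [ih]
      rw [integral_besselKernel_conv hμ hw hA (by positivity)]
      have : A + (n + 1) * A = ((n + 1 : ℕ) + 1) * A := by push_cast; ring
      rw [this]
    · rw [besselKernel, abs_mul, abs_of_nonneg (gammaKernel_nonneg hA x)]
      exact mul_le_of_le_one_right (gammaKernel_nonneg hA x) (hb _)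

/-! ### Trigonometric integrals -/

lemma integral_sin_pow_mul_cos_pow_succ_succ (p l : ℕ) :
    ∫ x in (0 : ℝ)..Real.pi, Real.sin x ^ p * Real.cos x ^ (l + 2) =
      (l + 1) / (p + l + 2) * ∫ x in (0 : ℝ)..Real.pi, Real.sin x ^ p * Real.cos x ^ l := by
  have hd : ∀ x ∈ Set.uIcc 0 Real.pi, HasDerivAt
      (fun x => Real.sin x ^ (p + 1) * Real.cos x ^ (l + 1))
      ((p + l + 2) * (Real.sin x ^ p * Real.cos x ^ (l + 2)) -
        (l + 1) * (Real.sin x ^ p * Real.cos x ^ l)) x := by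
    intro x _
    convert! ((Real.hasDerivAt_sin x).pow (p + 1)).mul ((Real.hasDerivAt_cos x).pow (l + 1)) using 1
    have hs := Real.sin_sq x
    simp only [Nat.add_sub_cancel, Pi.pow_apply]
    push_cast
    linear_combination (l + 1) * Real.sin x ^ p * Real.cos x ^ l * hs
  have h := intervalIntegral.integral_eq_sub_of_hasDerivAt hd
    (Continuous.intervalIntegrable (by fun_prop) _ _)
  rw [intervalIntegral.integral_sub (Continuous.intervalIntegrable (by fun_prop) _ _)
    (Continuous.intervalIntegrable (by fun_prop) _ _), intervalIntegral.integral_const_mul,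
    intervalIntegral.integral_const_mul] at h
  simp only [Real.sin_pi, Real.sin_zero, ne_eq, Nat.succ_ne_zero, not_false_eq_true, zero_pow,
    zero_mul, sub_zero] at h
  have : (p : ℝ) + l + 2 ≠ 0 := by positivity
  field_simp
  linarith

lemma integral_sin_pow_mul_cos_pow_odd_eq_zero (p i : ℕ) :
    ∫ x in (0 : ℝ)..Real.pi, Real.sin x ^ p * Real.cos x ^ (2 * i + 1) = 0 := by
  induction i with
  | zero =>
    have hd : ∀ x ∈ Set.uIcc 0 Real.pi, HasDerivAt (fun x => Real.sin x ^ (p + 1) / (p + 1))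
        (Real.sin x ^ p * Real.cos x ^ (2 * 0 + 1)) x := by
      intro x _
      convert! ((Real.hasDerivAt_sin x).pow (p + 1)).div_const ((p : ℝ) + 1) using 1
      have : (p : ℝ) + 1 ≠ 0 := by positivity
      simp only [Nat.add_sub_cancel]
      push_cast
      field_simp
    rw [intervalIntegral.integral_eq_sub_of_hasDerivAt hd
      (Continuous.intervalIntegrable (by fun_prop) _ _)]
    simp
  | succ i ih =>
    rw [show 2 * (i + 1) + 1 = 2 * i + 1 + 2 by ring, integral_sin_pow_mul_cos_pow_succ_succ, ih,
      mul_zero]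

lemma integral_sin_pow_eq_Gamma (p : ℕ) :
    ∫ x in (0 : ℝ)..Real.pi, Real.sin x ^ p =
      Real.Gamma ((p + 1) / 2) * √Real.pi / Real.Gamma ((p + 2) / 2) := by
  induction p using Nat.twoStepInduction with
  | zero =>
    norm_num [Real.Gamma_one_half_eq, Real.mul_self_sqrt Real.pi_pos.le]
  | one =>
    have h : Real.Gamma (3 / 2) = 1 / 2 * √Real.pi := by
      rw [show (3 / 2 : ℝ) = 1 / 2 + 1 by norm_num, Real.Gamma_add_one (by norm_num),
        Real.Gamma_one_half_eq]
    have : √Real.pi ≠ 0 := by positivity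
    norm_num [h, Real.Gamma_one]
    field_simp
  | more p ih _ =>
    rw [integral_sin_pow, ih]
    simp only [Real.sin_zero, Real.sin_pi, ne_eq, Nat.succ_ne_zero, not_false_eq_true, zero_pow,
      zero_mul, sub_zero, zero_div, zero_add]
    push_cast
    rw [show ((p : ℝ) + 2 + 1) / 2 = (p + 1) / 2 + 1 by ring,
      show ((p : ℝ) + 2 + 2) / 2 = (p + 2) / 2 + 1 by ring, Real.Gamma_add_one (by positivity),
      Real.Gamma_add_one (by positivity)]
    have := (Real.Gamma_pos_of_pos (show 0 < ((p : ℝ) + 2) / 2 by positivity)).ne'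
    field_simp

lemma Gamma_nat_add_half_eq (i : ℕ) :
    Real.Gamma (i + 1 / 2) = (2 * i).factorial * √Real.pi / (4 ^ i * i.factorial) := by
  induction i with
  | zero => simpa using Real.Gamma_one_half_eq
  | succ i ih =>
    rw [show ((i + 1 : ℕ) : ℝ) + 1 / 2 = i + 1 / 2 + 1 by push_cast; ring,
      Real.Gamma_add_one (by positivity), ih, show 2 * (i + 1) = 2 * i + 1 + 1 by ring,
      Nat.factorial_succ, Nat.factorial_succ, Nat.factorial_succ]
    push_cast
    field_simp
    ring

lemma integral_sin_pow_mul_cos_pow_even (p i : ℕ) :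
    ∫ x in (0 : ℝ)..Real.pi, Real.sin x ^ p * Real.cos x ^ (2 * i) =
      Real.Gamma ((p + 1) / 2) * Real.Gamma (i + 1 / 2) / Real.Gamma ((p + 2) / 2 + i) := by
  induction i with
  | zero =>
    simp only [mul_zero, pow_zero, mul_one, Nat.cast_zero, zero_add, add_zero,
      Real.Gamma_one_half_eq, integral_sin_pow_eq_Gamma]
  | succ i ih =>
    rw [show 2 * (i + 1) = 2 * i + 2 by ring, integral_sin_pow_mul_cos_pow_succ_succ, ih,
      show ((i + 1 : ℕ) : ℝ) + 1 / 2 = i + 1 / 2 + 1 by push_cast; ring,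
      show ((p : ℝ) + 2) / 2 + ((i + 1 : ℕ) : ℝ) = (p + 2) / 2 + i + 1 by push_cast; ring,
      Real.Gamma_add_one (by positivity), Real.Gamma_add_one (by positivity)]
    have := (Real.Gamma_pos_of_pos (show 0 < ((p : ℝ) + 2) / 2 + i by positivity)).ne'
    push_cast
    field_simp
    ring

/-- The `2 k`-th moment of a coordinate of a uniformly distributed unit vector of `ℝᵈ`. -/
def sphereMoment (d : ℝ) (k : ℕ) : ℝ :=
  (2 * k).factorial / (4 ^ k * k.factorial) * (Real.Gamma (d / 2) / Real.Gamma (k + d / 2))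

lemma sphereMoment_one (k : ℕ) : sphereMoment 1 k = 1 := by
  rw [sphereMoment, Gamma_nat_add_half_eq, Real.Gamma_one_half_eq]
  have : √Real.pi ≠ 0 := by positivity
  field_simp

lemma sum_range_even_of_odd_eq_zero (f : ℕ → ℝ) (hf : ∀ i, f (2 * i + 1) = 0) (k : ℕ) :
    ∑ l ∈ Finset.range (2 * k + 1), f l = ∑ i ∈ Finset.range (k + 1), f (2 * i) := by
  induction k with
  | zero => simp
  | succ k ih =>
    rw [show 2 * (k + 1) + 1 = 2 * k + 1 + 1 + 1 by ring, Finset.sum_range_succ,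
      Finset.sum_range_succ, ih, hf, add_zero, Finset.sum_range_succ _ (k + 1)]
    rfl

/-- The even moments of `x cos θ + √s sin θ V` where `θ` has density proportional to `sin ^ p` and
`V` is a coordinate of a uniform unit vector of `ℝ ^ (p + 1)`, independent of `θ`. -/
lemma sum_choose_mul_trig_even (p : ℕ) (x s : ℝ) (Y : ℕ → ℝ)
    (heven : ∀ j, Y (2 * j) = s ^ j * sphereMoment (p + 1) j) (k : ℕ) :
    ∑ l ∈ Finset.range (2 * k + 1), ((2 * k).choose l : ℝ) * x ^ l * Y (2 * k - l) *
        (∫ θ in (0 : ℝ)..Real.pi, Real.sin θ ^ (p + (2 * k - l)) * Real.cos θ ^ l) =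
      (x ^ 2 + s) ^ k * sphereMoment (p + 2) k *
        (√Real.pi * Real.Gamma ((p + 1) / 2) / Real.Gamma ((p + 2) / 2)) := by
  rw [sum_range_even_of_odd_eq_zero]
  · rw [add_pow, Finset.sum_mul, Finset.sum_mul]
    refine Finset.sum_congr rfl fun i hi => ?_
    obtain ⟨j, rfl⟩ := Nat.exists_eq_add_of_le (Nat.lt_succ_iff.1 (Finset.mem_range.1 hi))
    rw [show 2 * (i + j) - 2 * i = 2 * j by omega, heven, integral_sin_pow_mul_cos_pow_even,
      show i + j - i = j by omega, show 2 * (i + j) = 2 * i + 2 * j by ring,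
      Nat.cast_add_choose, Nat.cast_add_choose, Gamma_nat_add_half_eq, sphereMoment, sphereMoment,
      show 2 * (i + j) = 2 * i + 2 * j by ring]
    push_cast
    rw [show ((p : ℝ) + 2 * j + 1) / 2 = j + (p + 1) / 2 by ring,
      show ((p : ℝ) + 2 * j + 2) / 2 + i = i + j + (p + 2) / 2 by ring]
    have g1 := (Real.Gamma_pos_of_pos (show 0 < (j : ℝ) + (p + 1) / 2 by positivity)).ne'
    have g2 := (Real.Gamma_pos_of_pos (show 0 < (i : ℝ) + j + (p + 2) / 2 by positivity)).ne'
    have g3 := (Real.Gamma_pos_of_pos (show 0 < ((p : ℝ) + 2) / 2 by positivity)).ne'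
    rw [pow_add (4 : ℝ), pow_mul x]
    field_simp
  · intro i
    rw [integral_sin_pow_mul_cos_pow_odd_eq_zero, mul_zero]

/-- The odd moments vanish: in each term either the power of `cos` or the index of `Y` is odd. -/
lemma sum_choose_mul_trig_odd (p : ℕ) (x : ℝ) (Y : ℕ → ℝ) (hodd : ∀ j, Y (2 * j + 1) = 0) (k : ℕ) :
    ∑ l ∈ Finset.range (2 * k + 1 + 1), ((2 * k + 1).choose l : ℝ) * x ^ l * Y (2 * k + 1 - l) *
        (∫ θ in (0 : ℝ)..Real.pi, Real.sin θ ^ (p + (2 * k + 1 - l)) * Real.cos θ ^ l) = 0 := by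
  refine Finset.sum_eq_zero fun l hl => ?_
  have hl := Finset.mem_range.1 hl
  obtain ⟨i, rfl | rfl⟩ := Nat.even_or_odd' l
  · rw [show 2 * k + 1 - 2 * i = 2 * (k - i) + 1 by omega, hodd, mul_zero, zero_mul]
  · rw [integral_sin_pow_mul_cos_pow_odd_eq_zero, mul_zero]

/-! ### Moments of a uniformly distributed direction -/

/-- Adjoins a first polar angle. -/
def consAngle (m : ℕ) :
    ℝ × ((Fin m → ℝ) × ℝ) ≃ᵐ (Fin (m + 1) → ℝ) × ℝ :=
  MeasurableEquiv.prodAssoc.symm.trans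
    (MeasurableEquiv.prodCongr
      (MeasurableEquiv.piFinSuccAbove (fun _ : Fin (m + 1) => ℝ) 0).symm (MeasurableEquiv.refl ℝ))

lemma consAngle_apply {m : ℕ} (z : ℝ × ((Fin m → ℝ) × ℝ)) :
    consAngle m z = (Fin.cons z.1 z.2.1, z.2.2) := by
  have := piFinSuccAbove_symm_apply_eq_cons (z.1, z.2.1)
  simp only [consAngle, MeasurableEquiv.trans_apply]
  exact Prod.ext this rfl

lemma measurePreserving_consAngle (m : ℕ) : MeasurePreserving (consAngle m) := by
  refine MeasurePreserving.trans
    (e := MeasurableEquiv.prodAssoc.symm) (volume_preserving_prodAssoc.symm _) ?_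
  exact (measurePreserving_cons m).prod (MeasurePreserving.id volume)

lemma direction_consAngle_zero {m : ℕ} (z : ℝ × ((Fin m → ℝ) × ℝ)) :
    direction (m + 3) (consAngle m z) 0 = Real.cos z.1 := by
  rw [consAngle_apply]
  simp [direction]

lemma direction_consAngle_succ {m : ℕ} (z : ℝ × ((Fin m → ℝ) × ℝ)) (i : Fin (m + 2)) :
    direction (m + 3) (consAngle m z) i.succ = Real.sin z.1 * direction (m + 2) z.2 i := by
  rw [consAngle_apply]
  simp only [direction]
  have h1 : (∏ k ∈ Finset.univ.filter (fun k : Fin (m + 1) => (k : ℕ) < (i.succ : ℕ)),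
      Real.sin ((Fin.cons z.1 z.2.1 : Fin (m + 1) → ℝ) k)) = Real.sin z.1 *
      ∏ k ∈ Finset.univ.filter (fun k : Fin m => (k : ℕ) < (i : ℕ)), Real.sin (z.2.1 k) := by
    rw [Finset.prod_filter, Finset.prod_filter, Fin.prod_univ_succ]
    simp
  refine (congrArg₂ (· * ·) h1 ?_).trans (mul_assoc _ _ _)
  by_cases hi : (i : ℕ) < m
  · rw [dif_pos (show (i.succ : ℕ) < m + 3 - 2 by simp; omega),
      dif_pos (show (i : ℕ) < m + 2 - 2 by simpa using hi)]
    rfl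
  · rw [dif_neg (show ¬ (i.succ : ℕ) < m + 3 - 2 by simp; omega),
      dif_neg (show ¬ (i : ℕ) < m + 2 - 2 by simpa using hi)]
    simp

lemma angleDensity_consAngle {m : ℕ} (z : ℝ × ((Fin m → ℝ) × ℝ)) :
    angleDensity (m + 3) (consAngle m z) =
      Real.Gamma ((m + 3) / 2) / (√Real.pi * Real.Gamma ((m + 2) / 2)) *
        (Set.Icc 0 Real.pi).indicator (fun x => Real.sin x ^ (m + 1)) z.1 *
        angleDensity (m + 2) z.2 := by
  rw [consAngle_apply]
  have hb : ((∀ k : Fin (m + 1), (Fin.cons z.1 z.2.1 : Fin (m + 1) → ℝ) k ∈ Set.Icc 0 Real.pi) ∧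
      z.2.2 ∈ Set.Icc 0 (2 * Real.pi)) ↔ z.1 ∈ Set.Icc 0 Real.pi ∧
      ((∀ k : Fin m, z.2.1 k ∈ Set.Icc 0 Real.pi) ∧ z.2.2 ∈ Set.Icc 0 (2 * Real.pi)) := by
    rw [Fin.forall_fin_succ]
    simp only [Fin.cons_zero, Fin.cons_succ, and_assoc]
  have hp : ∏ k : Fin (m + 1), Real.sin ((Fin.cons z.1 z.2.1 : Fin (m + 1) → ℝ) k) ^
      (m + 3 - 2 - (k : ℕ)) = Real.sin z.1 ^ (m + 1) *
      ∏ k : Fin m, Real.sin (z.2.1 k) ^ (m + 2 - 2 - (k : ℕ)) := by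
    rw [Fin.prod_univ_succ]
    simp
  have hc : Real.Gamma (((m + 3 : ℕ) : ℝ) / 2) / (2 * Real.pi ^ (((m + 3 : ℕ) : ℝ) / 2)) =
      Real.Gamma ((m + 3) / 2) / (√Real.pi * Real.Gamma ((m + 2) / 2)) *
      (Real.Gamma (((m + 2 : ℕ) : ℝ) / 2) / (2 * Real.pi ^ (((m + 2 : ℕ) : ℝ) / 2))) := by
    push_cast
    rw [show ((m : ℝ) + 3) / 2 = (m + 2) / 2 + 1 / 2 by ring, Real.rpow_add Real.pi_pos,
      ← Real.sqrt_eq_rpow]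
    have g := (Real.Gamma_pos_of_pos (show 0 < ((m : ℝ) + 2) / 2 by positivity)).ne'
    field_simp
  unfold angleDensity
  by_cases h1 : z.1 ∈ Set.Icc 0 Real.pi
  · rw [Set.indicator_of_mem h1]
    by_cases h2 : (∀ k : Fin m, z.2.1 k ∈ Set.Icc 0 Real.pi) ∧ z.2.2 ∈ Set.Icc 0 (2 * Real.pi)
    · refine (if_pos (hb.2 ⟨h1, h2⟩)).trans ?_
      refine Eq.trans ?_ (congrArg _ (if_pos h2).symm)
      exact (congrArg₂ (· * ·) hc hp).trans (mul_mul_mul_comm _ _ _ _)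
    · refine (if_neg fun h => h2 (hb.1 h).2).trans ?_
      refine Eq.trans ?_ (congrArg _ (if_neg h2).symm)
      rw [mul_zero]
  · rw [Set.indicator_of_notMem h1, mul_zero, zero_mul]
    exact if_neg fun h => h1 (hb.1 h).1

/-- The support of the density of the angles. -/
def angleBox (d : ℕ) : Set (Angles d) :=
  (Set.univ.pi fun _ => Set.Icc 0 Real.pi) ×ˢ Set.Icc 0 (2 * Real.pi)

lemma isCompact_angleBox (d : ℕ) : IsCompact (angleBox d) :=
  (isCompact_univ_pi fun _ => isCompact_Icc).prod isCompact_Icc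

lemma angleDensity_eq_indicator (d : ℕ) : angleDensity d = (angleBox d).indicator fun p =>
    Real.Gamma ((d : ℝ) / 2) / (2 * Real.pi ^ ((d : ℝ) / 2)) *
      ∏ k : Fin (d - 2), Real.sin (p.1 k) ^ (d - 2 - (k : ℕ)) := by
  ext p
  unfold angleDensity
  by_cases h : (∀ k, p.1 k ∈ Set.Icc 0 Real.pi) ∧ p.2 ∈ Set.Icc 0 (2 * Real.pi)
  · rw [if_pos h, Set.indicator_of_mem]
    exact ⟨fun k _ => h.1 k, h.2⟩
  · rw [if_neg h, Set.indicator_of_notMem]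
    exact fun hp => h ⟨fun k => hp.1 k trivial, hp.2⟩

@[fun_prop]
lemma measurable_angleDensity (d : ℕ) : Measurable (angleDensity d) := by
  rw [angleDensity_eq_indicator]
  exact Measurable.indicator (by fun_prop) (isCompact_angleBox d).measurableSet

lemma angleDensity_nonneg {d : ℕ} (hd : 0 < d) (p : Angles d) : 0 ≤ angleDensity d p := by
  unfold angleDensity
  split_ifs with h
  · have := Real.Gamma_pos_of_pos (show 0 < (d : ℝ) / 2 by positivity)
    refine mul_nonneg (by positivity) (Finset.prod_nonneg fun k _ => pow_nonneg ?_ _)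
    exact Real.sin_nonneg_of_mem_Icc (h.1 k)
  · exact le_rfl

@[fun_prop]
lemma continuous_direction_apply (d : ℕ) (i : Fin d) : Continuous fun p => direction d p i := by
  unfold direction
  simp only
  refine Continuous.mul (by fun_prop) ?_
  split_ifs <;> fun_prop

lemma abs_direction_apply_le (d : ℕ) (p : Angles d) (i : Fin d) : |direction d p i| ≤ 1 := by
  unfold direction
  simp only [abs_mul, Finset.abs_prod]
  refine mul_le_one₀ (Finset.prod_le_one (fun _ _ => abs_nonneg _)
    fun k _ => Real.abs_sin_le_one _) (abs_nonneg _) ?_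
  split_ifs
  · exact Real.abs_cos_le_one _
  · exact Real.abs_cos_le_one _
  · exact Real.abs_sin_le_one _

lemma integrable_angleDensity_mul (d : ℕ) {g : Angles d → ℝ} (hg : Continuous g) :
    Integrable fun p => angleDensity d p * g p := by
  rw [angleDensity_eq_indicator]
  simp_rw [← Set.indicator_mul_left (angleBox d)]
  rw [integrable_indicator_iff (isCompact_angleBox d).measurableSet]
  exact ContinuousOn.integrableOn_compact (isCompact_angleBox d) (by fun_prop)

lemma integral_angleLaw {d : ℕ} (hd : 0 < d) (g : Angles d → ℝ) :
    ∫ p, g p ∂angleLaw d = ∫ p, angleDensity d p * g p := by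
  unfold angleLaw
  rw [integral_withDensity_eq_integral_toReal_smul (by fun_prop)
    (ae_of_all _ fun _ => ENNReal.ofReal_lt_top)]
  simp only [ENNReal.toReal_ofReal (angleDensity_nonneg hd _), smul_eq_mul]

lemma integral_indicator_Icc_pi (f : ℝ → ℝ) :
    ∫ x, (Set.Icc 0 Real.pi).indicator f x = ∫ x in (0 : ℝ)..Real.pi, f x := by
  rw [integral_indicator measurableSet_Icc, integral_Icc_eq_integral_Ioc,
    intervalIntegral.integral_of_le Real.pi_pos.le]

/-- Moments of a linear form of the direction in terms of those in one dimension less. -/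
lemma integral_pow_direction_succ {m : ℕ} (β : Fin (m + 3) → ℝ) (n : ℕ) :
    ∫ p, angleDensity (m + 3) p * (∑ i, β i * direction (m + 3) p i) ^ n =
      Real.Gamma ((m + 3) / 2) / (√Real.pi * Real.Gamma ((m + 2) / 2)) *
      ∑ l ∈ Finset.range (n + 1), (n.choose l : ℝ) * β 0 ^ l *
        (∫ q, angleDensity (m + 2) q *
          (∑ i : Fin (m + 2), β i.succ * direction (m + 2) q i) ^ (n - l)) *
        (∫ θ in (0 : ℝ)..Real.pi, Real.sin θ ^ (m + 1 + (n - l)) * Real.cos θ ^ l) := by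
  refine ((measurePreserving_consAngle m).integral_comp'
    (β := (Fin (m + 1) → ℝ) × ℝ) _).symm.trans ?_
  have hexp : ∀ z : ℝ × ((Fin m → ℝ) × ℝ), angleDensity (m + 3) (consAngle m z) *
      (∑ i, β i * direction (m + 3) (consAngle m z) i) ^ n =
      Real.Gamma ((m + 3) / 2) / (√Real.pi * Real.Gamma ((m + 2) / 2)) *
      ∑ l ∈ Finset.range (n + 1), ((n.choose l : ℝ) * β 0 ^ l) *
        ((Set.Icc 0 Real.pi).indicator
          (fun x => Real.sin x ^ (m + 1 + (n - l)) * Real.cos x ^ l) z.1 *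
        (angleDensity (m + 2) z.2 *
          (∑ i : Fin (m + 2), β i.succ * direction (m + 2) z.2 i) ^ (n - l))) := by
    intro z
    rw [Fin.sum_univ_succ]
    simp only [direction_consAngle_zero, direction_consAngle_succ, angleDensity_consAngle]
    have : ∑ i : Fin (m + 2), β i.succ * (Real.sin z.1 * direction (m + 2) z.2 i) =
        Real.sin z.1 * ∑ i : Fin (m + 2), β i.succ * direction (m + 2) z.2 i := by
      rw [Finset.mul_sum]
      exact Finset.sum_congr rfl fun _ _ => by ring
    rw [this, add_pow, mul_assoc, mul_assoc]
    congr 1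
    rw [Finset.mul_sum, Finset.mul_sum]
    refine Finset.sum_congr rfl fun l _ => ?_
    by_cases hz : z.1 ∈ Set.Icc 0 Real.pi
    · simp only [Set.indicator_of_mem hz, mul_pow]
      ring
    · simp [Set.indicator_of_notMem hz]
  simp_rw [hexp]
  rw [integral_const_mul, integral_finsetSum]
  · congr 1
    refine Finset.sum_congr rfl fun l _ => ?_
    have hpm := integral_prod_mul (μ := volume) (ν := volume)
      ((Set.Icc 0 Real.pi).indicator fun x => Real.sin x ^ (m + 1 + (n - l)) * Real.cos x ^ l)
      (fun q : Angles (m + 2) => angleDensity (m + 2) q *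
        (∑ i : Fin (m + 2), β i.succ * direction (m + 2) q i) ^ (n - l))
    rw [integral_indicator_Icc_pi] at hpm
    rw [integral_const_mul]
    refine (congrArg _ hpm).trans ?_
    ring
  · intro l _
    refine Integrable.const_mul ?_ _
    refine Integrable.mul_prod (μ := volume) (ν := volume)
      (f := (Set.Icc 0 Real.pi).indicator fun x =>
        Real.sin x ^ (m + 1 + (n - l)) * Real.cos x ^ l)
      (g := fun q : Angles (m + 2) => angleDensity (m + 2) q *
        (∑ i : Fin (m + 2), β i.succ * direction (m + 2) q i) ^ (n - l)) ?_ ?_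
    · rw [integrable_indicator_iff measurableSet_Icc]
      exact ContinuousOn.integrableOn_compact isCompact_Icc (by fun_prop)
    · exact integrable_angleDensity_mul (m + 2) (by fun_prop)

/-- The integral over the circle in the form of the recursion on the dimension: reflection of the
lower half circle replaces `y` by `± y`, each with probability `1 / 2`, that is, by a uniform
direction in dimension one. -/
lemma integral_zero_two_pi_fold (n : ℕ) (x y : ℝ) :
    ∫ φ in (0 : ℝ)..(2 * Real.pi), (x * Real.cos φ + y * Real.sin φ) ^ n =
      2 * ∑ l ∈ Finset.range (n + 1), (n.choose l : ℝ) * x ^ l *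
        ((y ^ (n - l) + (-y) ^ (n - l)) / 2) *
        (∫ θ in (0 : ℝ)..Real.pi, Real.sin θ ^ (0 + (n - l)) * Real.cos θ ^ l) := by
  have h1 : ∫ φ in Real.pi..(2 * Real.pi), (x * Real.cos φ + y * Real.sin φ) ^ n =
      ∫ φ in (0 : ℝ)..Real.pi, (x * Real.cos φ + (-y) * Real.sin φ) ^ n := by
    have := intervalIntegral.integral_comp_sub_left (a := 0) (b := Real.pi)
      (fun φ => (x * Real.cos φ + y * Real.sin φ) ^ n) (2 * Real.pi)
    rw [show 2 * Real.pi - Real.pi = Real.pi by ring, sub_zero] at this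
    rw [← this]
    simp only [Real.cos_two_pi_sub, Real.sin_two_pi_sub, mul_neg, neg_mul]
  have h2 : ∀ y : ℝ, ∫ φ in (0 : ℝ)..Real.pi, (x * Real.cos φ + y * Real.sin φ) ^ n =
      ∑ l ∈ Finset.range (n + 1), (n.choose l : ℝ) * x ^ l * y ^ (n - l) *
        (∫ θ in (0 : ℝ)..Real.pi, Real.sin θ ^ (0 + (n - l)) * Real.cos θ ^ l) := by
    intro y
    simp_rw [add_pow, ← intervalIntegral.integral_const_mul]
    rw [intervalIntegral.integral_finsetSum
      fun _ _ => Continuous.intervalIntegrable (by fun_prop) _ _]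
    refine Finset.sum_congr rfl fun l _ => ?_
    refine intervalIntegral.integral_congr fun θ _ => ?_
    simp only [zero_add, mul_pow]
    ring
  rw [← intervalIntegral.integral_add_adjacent_intervals (b := Real.pi)
    (Continuous.intervalIntegrable (by fun_prop) _ _)
    (Continuous.intervalIntegrable (by fun_prop) _ _), h1, h2, h2, ← Finset.sum_add_distrib,
    Finset.mul_sum]
  exact Finset.sum_congr rfl fun _ _ => by ring

lemma integral_pow_direction_two (β : Fin 2 → ℝ) (n : ℕ) :
    ∫ p, angleDensity 2 p * (∑ i, β i * direction 2 p i) ^ n =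
      (1 / (2 * Real.pi)) *
        ∫ φ in (0 : ℝ)..(2 * Real.pi), (β 0 * Real.cos φ + β 1 * Real.sin φ) ^ n := by
  have hexp : ∀ p : (Fin 0 → ℝ) × ℝ, angleDensity 2 p * (∑ i, β i * direction 2 p i) ^ n =
      1 * (Set.Icc 0 (2 * Real.pi)).indicator
        (fun φ => (1 / (2 * Real.pi)) * (β 0 * Real.cos φ + β 1 * Real.sin φ) ^ n) p.2 := by
    intro p
    have hb : p ∈ angleBox 2 ↔ p.2 ∈ Set.Icc 0 (2 * Real.pi) :=
      ⟨fun h => h.2, fun h => ⟨fun k => k.elim0, h⟩⟩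
    have hd0 : direction 2 p 0 = Real.cos p.2 := by simp [direction]
    have hd1 : direction 2 p 1 = Real.sin p.2 := by simp [direction]
    rw [angleDensity_eq_indicator, Fin.sum_univ_two, hd0, hd1, one_mul]
    by_cases h : p.2 ∈ Set.Icc 0 (2 * Real.pi)
    · rw [Set.indicator_of_mem (hb.2 h), Set.indicator_of_mem h]
      simp
    · rw [Set.indicator_of_notMem (mt hb.1 h), Set.indicator_of_notMem h, zero_mul]
  have h := integral_congr_ae (μ := (volume : Measure ((Fin 0 → ℝ) × ℝ))) (ae_of_all _ hexp)
  refine h.trans ?_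
  rw [Measure.volume_eq_prod, integral_prod_mul (fun _ : Fin 0 → ℝ => (1 : ℝ)),
    integral_indicator measurableSet_Icc, integral_Icc_eq_integral_Ioc,
    ← intervalIntegral.integral_of_le (by positivity), intervalIntegral.integral_const_mul]
  rw [volume_pi, Measure.pi_of_empty _ 0, integral_dirac, one_mul]

/-- The moments of a linear form of a uniformly distributed direction, by induction on the
dimension. -/
lemma integral_pow_direction (m : ℕ) (β : Fin (m + 2) → ℝ) (k : ℕ) :
    (∫ p, angleDensity (m + 2) p * (∑ i, β i * direction (m + 2) p i) ^ (2 * k) =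
      (∑ i, β i ^ 2) ^ k * sphereMoment (m + 2) k) ∧
    ∫ p, angleDensity (m + 2) p * (∑ i, β i * direction (m + 2) p i) ^ (2 * k + 1) = 0 := by
  induction m generalizing k with
  | zero =>
    have e := integral_pow_direction_two β (2 * k)
    have o := integral_pow_direction_two β (2 * k + 1)
    rw [integral_zero_two_pi_fold] at e o
    have e' := sum_choose_mul_trig_even 0 (β 0) (β 1 ^ 2)
      (fun l => (β 1 ^ l + (-β 1) ^ l) / 2)
      (fun j => by rw [(even_two_mul j).neg_pow]; norm_num [sphereMoment_one, pow_mul]) k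
    have o' := sum_choose_mul_trig_odd 0 (β 0)
      (fun l => (β 1 ^ l + (-β 1) ^ l) / 2)
      (fun j => by rw [(odd_two_mul_add_one j).neg_pow]; ring) k
    rw [e'] at e
    rw [o'] at o
    constructor
    · refine e.trans ?_
      change _ = (∑ i : Fin 2, β i ^ 2) ^ k * _
      rw [Fin.sum_univ_two]
      norm_num [Real.Gamma_one_half_eq, Real.mul_self_sqrt Real.pi_pos.le]
      field_simp
    · refine o.trans ?_
      simp
  | succ m ih =>
    have e := integral_pow_direction_succ β (2 * k)
    have o := integral_pow_direction_succ β (2 * k + 1)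
    have e' := sum_choose_mul_trig_even (m + 1) (β 0) (∑ i : Fin (m + 2), β i.succ ^ 2)
      (fun l => ∫ q, angleDensity (m + 2) q *
          (∑ i : Fin (m + 2), β i.succ * direction (m + 2) q i) ^ l)
      (fun j => by
        rw [(ih (fun i => β i.succ) j).1]
        push_cast
        ring_nf) k
    have o' := sum_choose_mul_trig_odd (m + 1) (β 0)
      (fun l => ∫ q, angleDensity (m + 2) q *
          (∑ i : Fin (m + 2), β i.succ * direction (m + 2) q i) ^ l)
      (fun j => (ih (fun i => β i.succ) j).2) k
    rw [e'] at e
    rw [o'] at o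
    constructor
    · refine e.trans ?_
      rw [show ∑ i : Fin (m + 1 + 2), β i ^ 2 = β 0 ^ 2 + ∑ i : Fin (m + 2), β i.succ ^ 2 from
        Fin.sum_univ_succ _]
      push_cast
      rw [show ((m : ℝ) + 1 + 1) / 2 = (m + 2) / 2 by ring,
        show ((m : ℝ) + 1 + 2) = m + 3 by ring]
      have g1 := (Real.Gamma_pos_of_pos (show 0 < ((m : ℝ) + 2) / 2 by positivity)).ne'
      have g2 := (Real.Gamma_pos_of_pos (show 0 < ((m : ℝ) + 3) / 2 by positivity)).ne'
      have : √Real.pi ≠ 0 := by positivity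
      field_simp
    · refine o.trans ?_
      simp

/-! ### Characteristic functions -/

lemma isProbabilityMeasure_angleLaw {d : ℕ} (hd : 2 ≤ d) : IsProbabilityMeasure (angleLaw d) := by
  obtain ⟨m, rfl⟩ := Nat.exists_eq_add_of_le' hd
  have h := (integral_pow_direction m 0 0).1
  have hi := integrable_angleDensity_mul (m + 2) (g := fun _ => (1 : ℝ)) continuous_const
  have g := (Real.Gamma_pos_of_pos (show 0 < ((m : ℝ) + 2) / 2 by positivity)).ne'
  simp only [mul_zero, pow_zero, mul_one, sphereMoment, Nat.factorial_zero, Nat.cast_one, div_one,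
    Nat.cast_zero, zero_add, div_self g] at h
  simp only [mul_one] at hi
  constructor
  rw [angleLaw, withDensity_apply _ MeasurableSet.univ, Measure.restrict_univ,
    ← ofReal_integral_eq_lintegral_ofReal hi
      (ae_of_all _ fun p => angleDensity_nonneg (Nat.succ_pos _) p), h, ENNReal.ofReal_one]

/-- The characteristic function of the uniform distribution on the unit sphere of `ℝᵈ`. -/
lemma integral_exp_direction {d : ℕ} (hd : 2 ≤ d) (β : EuclideanSpace ℝ (Fin d)) :
    ∫ p, Complex.exp (Complex.I * ((∑ i, β i * direction d p i : ℝ) : ℂ)) ∂angleLaw d =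
      (normBessel ((d : ℝ) / 2 - 1) ‖β‖ : ℂ) := by
  have := isProbabilityMeasure_angleLaw hd
  obtain ⟨m, rfl⟩ := Nat.exists_eq_add_of_le' hd
  set L : Angles (m + 2) → ℝ := fun p => ∑ i, β i * direction (m + 2) p i with hL
  have hLc : Continuous L := by fun_prop
  set B : ℝ := ∑ i, |β i| with hB
  have hLB : ∀ p, |L p| ≤ B := fun p => (Finset.abs_sum_le_sum_abs _ _).trans <|
    Finset.sum_le_sum fun i _ => by
      rw [abs_mul]
      exact mul_le_of_le_one_right (abs_nonneg _) (abs_direction_apply_le _ _ _)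
  set F : ℕ → Angles (m + 2) → ℂ := fun n p => (n.factorial : ℂ)⁻¹ * (Complex.I * (L p : ℂ)) ^ n
    with hF
  have hFn : ∀ n p, ‖F n p‖ ≤ B ^ n / n.factorial := by
    intro n p
    simp only [hF, norm_mul, norm_pow, norm_inv, Complex.norm_I, one_mul, Complex.norm_real,
      Complex.norm_natCast, Real.norm_eq_abs]
    rw [div_eq_inv_mul]
    gcongr
    exact hLB p
  have hFi : ∀ n, Integrable (F n) (angleLaw (m + 2)) := by
    intro n
    have hc : Continuous (F n) := by fun_prop
    exact Integrable.of_bound hc.measurable.aestronglyMeasurable _ (ae_of_all _ (hFn n))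
  have hsum : Summable fun n => ∫ p, ‖F n p‖ ∂angleLaw (m + 2) := by
    refine Summable.of_nonneg_of_le (fun n => integral_nonneg fun _ => norm_nonneg _) (fun n => ?_)
      (Real.summable_pow_div_factorial B)
    calc ∫ p, ‖F n p‖ ∂angleLaw (m + 2) ≤ ∫ _, B ^ n / n.factorial ∂angleLaw (m + 2) :=
          integral_mono (hFi n).norm (integrable_const _) (hFn n)
      _ = _ := by simp
  have hS := hasSum_integral_of_summable_integral_norm hFi hsum
  have hexp : ∀ p, ∑' n, F n p = Complex.exp (Complex.I * (L p : ℂ)) := by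
    intro p
    rw [Complex.exp_eq_exp_ℂ, NormedSpace.exp_eq_tsum ℂ]
    simp only [hF, smul_eq_mul]
  simp_rw [hexp] at hS
  have hFint : ∀ n, ∫ p, F n p ∂angleLaw (m + 2) =
      (n.factorial : ℂ)⁻¹ * Complex.I ^ n *
        ((∫ p, angleDensity (m + 2) p * L p ^ n : ℝ) : ℂ) := by
    intro n
    rw [← integral_angleLaw (Nat.succ_pos _) (fun p => L p ^ n), ← integral_complex_ofReal,
      ← integral_const_mul]
    refine integral_congr_ae (ae_of_all _ fun p => ?_)
    simp only [hF, mul_pow, Complex.ofReal_pow]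
    ring
  simp_rw [hFint] at hS
  rw [← (mul_right_injective₀ (two_ne_zero (α := ℕ))).hasSum_iff] at hS
  · rw [← hS.tsum_eq, normBessel, Complex.ofReal_tsum]
    refine tsum_congr fun k => ?_
    simp only [Function.comp_apply]
    rw [(integral_pow_direction m (fun i => β i) k).1, sphereMoment, pow_mul Complex.I,
      Complex.I_sq, ← EuclideanSpace.real_norm_sq_eq, div_pow, pow_mul ‖β‖, pow_mul (2 : ℝ)]
    push_cast
    rw [show ((m : ℝ) + 2) / 2 - 1 + 1 = (m + 2) / 2 by ring,
      show (k : ℝ) + ((m + 2) / 2 - 1) + 1 = k + (m + 2) / 2 by ring]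
    have h1 : ((2 * k).factorial : ℂ) ≠ 0 := by exact_mod_cast (2 * k).factorial_ne_zero
    have h2 : (k.factorial : ℂ) ≠ 0 := by exact_mod_cast k.factorial_ne_zero
    have h3 : (Real.Gamma (k + (m + 2) / 2) : ℂ) ≠ 0 := by
      exact_mod_cast (Real.Gamma_pos_of_pos (by positivity)).ne'
    norm_num
    field_simp
  · intro n hn
    obtain ⟨k, rfl | rfl⟩ := Nat.even_or_odd' n
    · exact absurd ⟨k, rfl⟩ hn
    · rw [(integral_pow_direction m (fun i => β i) k).2]
      simp

/-- A characteristic function is bounded by `1`. -/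
lemma abs_normBessel_le_one {d : ℕ} (hd : 2 ≤ d) (x : ℝ) :
    |normBessel ((d : ℝ) / 2 - 1) x| ≤ 1 := by
  have := isProbabilityMeasure_angleLaw hd
  have h := integral_exp_direction hd (EuclideanSpace.single ⟨0, by omega⟩ x)
  have hx : normBessel ((d : ℝ) / 2 - 1) ‖x‖ = normBessel ((d : ℝ) / 2 - 1) x := by
    rcases abs_choice x with hx | hx <;> rw [Real.norm_eq_abs, hx]
    exact normBessel_neg _ _
  rw [PiLp.norm_single, hx] at h
  rw [← Real.norm_eq_abs, ← Complex.norm_real, ← h]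
  refine (norm_integral_le_integral_norm _).trans_eq ?_
  simp_rw [mul_comm Complex.I, Complex.norm_exp_ofReal_mul_I]
  simp

lemma inner_position {d n : ℕ} (c t : ℝ) (τ : Fin n → ℝ) (p : Fin (n + 1) → Angles d)
    (α : EuclideanSpace ℝ (Fin d)) :
    inner ℝ α (position c t τ p) =
      ∑ j, ∑ i, ((c * intertime t τ j) • α) i * direction d (p j) i := by
  rw [position, inner_smul_right, inner_sum, Finset.mul_sum]
  refine Finset.sum_congr rfl fun j _ => ?_
  rw [inner_smul_right, PiLp.inner_apply, Finset.mul_sum, Finset.mul_sum]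
  refine Finset.sum_congr rfl fun i _ => ?_
  simp
  ring

/-- Conditionally on the intertimes, the characteristic function of the position is a product of
characteristic functions of uniform directions. -/
lemma integral_exp_position {Ω : Type*} [MeasurableSpace Ω] {P : Measure Ω}
    [IsProbabilityMeasure P] {d n : ℕ} (hd : 2 ≤ d) {c t : ℝ}
    {τ : Ω → Fin n → ℝ} {θ : Fin (n + 1) → Ω → Angles d}
    (hθ : ∀ j, HasLaw (θ j) (angleLaw d) P) (hθindep : iIndepFun θ P)
    (hτθ : IndepFun τ (fun ω j => θ j ω) P) {ν : Measure (Fin n → ℝ)} (hτ : HasLaw τ ν P)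
    (α : EuclideanSpace ℝ (Fin d)) :
    ∫ ω, Complex.exp (Complex.I * (inner ℝ α (position c t (τ ω) (fun j => θ j ω)) : ℝ)) ∂P =
      ((∫ s, ∏ j, normBessel ((d : ℝ) / 2 - 1) (c * ‖α‖ * intertime t s j) ∂ν : ℝ) : ℂ) := by
  have := isProbabilityMeasure_angleLaw hd
  obtain ⟨ρ, hρ⟩ : ∃ ρ : Measure (Fin (n + 1) → Angles d),
      ρ = Measure.pi fun _ : Fin (n + 1) => angleLaw d := ⟨_, rfl⟩
  have : IsProbabilityMeasure ρ := hρ ▸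
    Measure.pi.instIsProbabilityMeasure (α := fun _ => Angles d) (fun _ => angleLaw d)
  have : IsProbabilityMeasure ν := hτ.isProbabilityMeasure_iff.1 inferInstance
  have hlaw := (indepFun_iff_hasLaw_prodMk_prod hτ (hθindep.hasLaw_pi hθ)).1 hτθ
  rw [← hρ] at hlaw
  set G : (Fin n → ℝ) × (Fin (n + 1) → Angles d) → ℂ := fun z =>
    Complex.exp (Complex.I * (inner ℝ α (position c t z.1 z.2) : ℝ)) with hG
  have hGm : Measurable G := by
    simp only [hG, inner_position]
    have h1 : ∀ j, Measurable fun z : (Fin n → ℝ) × (Fin (n + 1) → Angles d) =>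
        intertime t z.1 j := fun j => (measurable_intertime t j).comp measurable_fst
    have h2 : ∀ j i, Measurable fun z : (Fin n → ℝ) × (Fin (n + 1) → Angles d) =>
        direction d (z.2 j) i := fun j i =>
      (continuous_direction_apply d i).measurable.comp ((measurable_pi_apply j).comp measurable_snd)
    simp only [PiLp.smul_apply, smul_eq_mul]
    fun_prop
  have hGi : Integrable G (ν.prod ρ) :=
    Integrable.of_bound hGm.aestronglyMeasurable 1 (ae_of_all _ fun z => by
      simp [hG, mul_comm Complex.I, Complex.norm_exp_ofReal_mul_I])
  have h := hlaw.integral_comp (f := G) hGm.aestronglyMeasurable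
  refine h.trans ?_
  rw [integral_prod _ hGi, ← integral_complex_ofReal]
  refine integral_congr_ae (ae_of_all _ fun s => ?_)
  have hGp : ∀ p, G (s, p) = ∏ j, Complex.exp (Complex.I *
      ((∑ i, ((c * intertime t s j) • α) i * direction d (p j) i : ℝ) : ℂ)) := by
    intro p
    simp only [hG, inner_position]
    rw [← Complex.exp_sum, Complex.ofReal_sum, Finset.mul_sum]
  simp only [hGp]
  rw [hρ, integral_fintype_prod_eq_prod (fun j p => Complex.exp (Complex.I *
      ((∑ i, ((c * intertime t s j) • α) i * direction d p i : ℝ) : ℂ))), Complex.ofReal_prod]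
  refine Finset.prod_congr rfl fun j _ => ?_
  rw [integral_exp_direction hd, norm_smul, Real.norm_eq_abs]
  congr 1
  rw [mul_right_comm c]
  -- Almost surely the intertime is positive, but evenness of `normBessel` makes this unnecessary.
  rcases abs_choice (c * intertime t s j) with h | h <;> rw [h]
  rw [neg_mul, normBessel_neg]

lemma intertime_pos_iff {n : ℕ} (t : ℝ) (τ : Fin n → ℝ) :
    (∀ j, 0 < intertime t τ j) ↔ (∀ i, 0 < τ i) ∧ ∑ i, τ i < t := by
  rw [Fin.forall_fin_succ']
  simp [intertime]

lemma dirichletDensity_eq {n : ℕ} {a : ℝ} (ha : 0 < a) (t : ℝ) (τ : Fin n → ℝ) :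
    dirichletDensity n a t τ = Real.Gamma ((n + 1) * a) * (1 / t ^ ((n + 1) * a - 1)) *
      ∏ j, gammaKernel a (intertime t τ j) := by
  unfold dirichletDensity
  by_cases h : (∀ i, 0 < τ i) ∧ ∑ i, τ i < t
  · rw [if_pos h]
    have h' := (intertime_pos_iff t τ).2 h
    simp only [gammaKernel_of_pos (h' _), Finset.prod_div_distrib, Finset.prod_const,
      Finset.card_univ, Fintype.card_fin]
    have := (Real.Gamma_pos_of_pos ha).ne'
    field_simp
  · rw [if_neg h]
    have h' := mt (intertime_pos_iff t τ).1 h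
    push Not at h'
    obtain ⟨j, hj⟩ := h'
    rw [Finset.prod_eq_zero (Finset.mem_univ j) (gammaKernel_of_nonpos hj), mul_zero]

lemma integral_dirichletLaw {n : ℕ} {a t : ℝ} (ha : 0 < a) (ht : 0 < t) (g : (Fin n → ℝ) → ℝ) :
    ∫ τ, g τ ∂dirichletLaw n a t =
      Real.Gamma ((n + 1) * a) * (1 / t ^ ((n + 1) * a - 1)) *
        ∫ τ, (∏ j, gammaKernel a (intertime t τ j)) * g τ := by
  have hm : Measurable (dirichletDensity n a t) := by
    have : dirichletDensity n a t = fun τ => Real.Gamma ((n + 1) * a) *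
        (1 / t ^ ((n + 1) * a - 1)) * ∏ j, gammaKernel a (intertime t τ j) :=
      funext fun τ => dirichletDensity_eq ha t τ
    rw [this]
    exact (Finset.measurable_prod _ fun j _ =>
      (measurable_gammaKernel a).comp (measurable_intertime t j)).const_mul _
  have hnn : ∀ τ, 0 ≤ dirichletDensity n a t τ := by
    intro τ
    rw [dirichletDensity_eq ha]
    have := Real.Gamma_pos_of_pos (show 0 < ((n : ℝ) + 1) * a by positivity)
    exact mul_nonneg (by positivity) (Finset.prod_nonneg fun j _ => gammaKernel_nonneg ha _)
  unfold dirichletLaw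
  rw [integral_withDensity_eq_integral_toReal_smul hm.ennreal_ofReal
    (ae_of_all _ fun _ => ENNReal.ofReal_lt_top), ← integral_const_mul]
  refine integral_congr_ae (ae_of_all _ fun τ => ?_)
  simp only [ENNReal.toReal_ofReal (hnn _), smul_eq_mul]
  rw [dirichletDensity_eq ha, mul_assoc]

/-- The Dirichlet average of a product of normalized Bessel functions is a normalized Bessel
function, whenever the weights of their series are of convolution type. -/
lemma integral_prod_normBessel_dirichletLaw {μ : ℝ → ℝ} (hμ : ∀ A, 0 < A → 0 < μ A + 1)
    (hw : ∀ A B, 0 < A → 0 < B → ∀ k,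
      ∑ p ∈ Finset.HasAntidiagonal.antidiagonal k,
        besselWeight A (μ A) p.1 * besselWeight B (μ B) p.2 = besselWeight (A + B) (μ (A + B)) k)
    {a t : ℝ} (ha : 0 < a) (ht : 0 < t) (hb : ∀ x, |normBessel (μ a) x| ≤ 1) (κ : ℝ) (n : ℕ) :
    ∫ τ : Fin n → ℝ, ∏ j, normBessel (μ a) (κ * intertime t τ j) ∂dirichletLaw n a t =
      normBessel (μ ((n + 1) * a)) (κ * t) := by
  rw [integral_dirichletLaw ha ht]
  simp_rw [← Finset.prod_mul_distrib]
  have h := integral_prod_besselKernel hμ hw ha hb κ n t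
  simp only [besselKernel] at h
  rw [h, gammaKernel_of_pos ht]
  have h1 := (Real.Gamma_pos_of_pos (show 0 < ((n : ℝ) + 1) * a by positivity)).ne'
  have h2 := (Real.rpow_pos_of_pos ht ((n + 1) * a - 1)).ne'
  field_simp

end RandomFlight

end

open RandomFlight in
theorem theorem1 {Ω : Type*} [MeasurableSpace Ω] (P : Measure Ω) [IsProbabilityMeasure P]
    (d n : ℕ) (hd : 2 ≤ d) (hn : 1 ≤ n) (c t : ℝ) (hc : 0 < c) (ht : 0 < t)
    (τ : Ω → Fin n → ℝ) (θ : Fin (n + 1) → Ω → Angles d)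
    (hθ : ∀ j, HasLaw (θ j) (angleLaw d) P)
    (hθindep : iIndepFun θ P)
    (hτθ : IndepFun τ (fun ω j => θ j ω) P) :
    (HasLaw τ (dirichletLaw n ((d : ℝ) - 1) t) P →
      ∀ α : EuclideanSpace ℝ (Fin d),
        (α ≠ 0 →
          ∫ ω, Complex.exp
              (Complex.I * (inner ℝ α (position c t (τ ω) (fun j => θ j ω)) : ℝ)) ∂P =
            (((2 : ℝ) ^ (((n : ℝ) + 1) / 2 * ((d : ℝ) - 1) - 1 / 2) *
                Real.Gamma (((n : ℝ) + 1) / 2 * ((d : ℝ) - 1) + 1 / 2) /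
                (c * t * ‖α‖) ^ (((n : ℝ) + 1) / 2 * ((d : ℝ) - 1) - 1 / 2) *
              besselJ (((n : ℝ) + 1) / 2 * ((d : ℝ) - 1) - 1 / 2) (c * t * ‖α‖) : ℝ) : ℂ)) ∧
        (α = 0 →
          ∫ ω, Complex.exp
              (Complex.I * (inner ℝ α (position c t (τ ω) (fun j => θ j ω)) : ℝ)) ∂P = 1)) ∧
    (3 ≤ d → HasLaw τ (dirichletLaw n ((d : ℝ) / 2 - 1) t) P →
      ∀ α : EuclideanSpace ℝ (Fin d),
        (α ≠ 0 →
          ∫ ω, Complex.exp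
              (Complex.I * (inner ℝ α (position c t (τ ω) (fun j => θ j ω)) : ℝ)) ∂P =
            (((2 : ℝ) ^ (((n : ℝ) + 1) * ((d : ℝ) / 2 - 1)) *
                Real.Gamma (((n : ℝ) + 1) * ((d : ℝ) / 2 - 1) + 1) /
                (c * t * ‖α‖) ^ (((n : ℝ) + 1) * ((d : ℝ) / 2 - 1)) *
              besselJ (((n : ℝ) + 1) * ((d : ℝ) / 2 - 1)) (c * t * ‖α‖) : ℝ) : ℂ)) ∧
        (α = 0 →
          ∫ ω, Complex.exp
              (Complex.I * (inner ℝ α (position c t (τ ω) (fun j => θ j ω)) : ℝ)) ∂P = 1)) := by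
  have hd' : (2 : ℝ) ≤ d := by exact_mod_cast hd
  have hzero : ∀ α : EuclideanSpace ℝ (Fin d), α = 0 →
      ∫ ω, Complex.exp
        (Complex.I * (inner ℝ α (position c t (τ ω) (fun j => θ j ω)) : ℝ)) ∂P = 1 := by
    rintro α rfl
    simp
  refine ⟨fun hτ α => ⟨fun hα => ?_, hzero α⟩, fun hd3 hτ α => ⟨fun hα => ?_, hzero α⟩⟩
  · have ha : (0 : ℝ) < d - 1 := by linarith
    have hμ : (d : ℝ) / 2 - 1 = (d - 1) / 2 - 1 / 2 := by ring
    have hr : 0 < c * t * ‖α‖ := by positivity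
    have hN : (1 : ℝ) / 2 ≤ ((n : ℝ) + 1) / 2 * (d - 1) := by
      nlinarith [(Nat.cast_nonneg n : (0 : ℝ) ≤ n)]
    have key := integral_prod_normBessel_dirichletLaw (μ := fun A => A / 2 - 1 / 2)
      (fun A hA => by linarith) (fun A B hA hB k => sum_antidiagonal_besselWeight_half hA hB k)
      ha ht (fun x => hμ ▸ abs_normBessel_le_one hd x) (c * ‖α‖) n
    rw [integral_exp_position hd hθ hθindep hτθ hτ, hμ, key,
      show ((n : ℝ) + 1) / 2 * (d - 1) + 1 / 2 = ((n : ℝ) + 1) / 2 * (d - 1) - 1 / 2 + 1 by ring,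
      besselJ_eq_normBessel (by linarith) hr,
      show ((n : ℝ) + 1) * (d - 1) / 2 = ((n : ℝ) + 1) / 2 * (d - 1) by ring, mul_right_comm c]
  · have ha : (0 : ℝ) < d / 2 - 1 := by
      have : (3 : ℝ) ≤ d := by exact_mod_cast hd3
      linarith
    have hr : 0 < c * t * ‖α‖ := by positivity
    have key := integral_prod_normBessel_dirichletLaw (μ := fun A => A)
      (fun A hA => by linarith) (fun A B hA hB k => sum_antidiagonal_besselWeight_self hA hB k)
      ha ht (abs_normBessel_le_one hd) (c * ‖α‖) n
    rw [integral_exp_position hd hθ hθindep hτθ hτ, key,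
      besselJ_eq_normBessel (by positivity) hr, mul_right_comm c]
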